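/- An item is a positive integer (its size), a bunch is a finite multiset of items, and a configuration is a finite multiset of bunches. Fix a capacity $\kappa$. The volume $\mathrm{vol}(B)$ of a bunch is the sum of its items, and $\mathrm{slack}(B)=\kappa-\mathrm{vol}(B)$. A configuration is legal if all its bunches have volume at most $\kappa$. Two legal configurations are adjacent if one arises from the other by moving a single item from one bunch to another, so that exactly two bunches change. A configuration $\mathcal C_S$ can be reconfigured to $\mathcal C_T$ if there is a finite sequence of legal configurations from $\mathcal C_S$ to $\mathcal C_T$ in which consecutive configurations are adjacent (a reconfiguration sequence). For a size $s$ and a bunch $B$ let $B_{\ge s}$ be the multiset of items of $B$ of size at least $s$. Size $s$ is settled in $\mathcal C$ (with respect to $\mathcal C_T$) if there is a bijection $\varphi$ from the bunches of $\mathcal C$ that contain an item of size at least $s$ to the bunches of $\mathcal C_T$ that contain an item of size at least $s$, with $B_{\ge s}=\varphi(B)_{\ge s}$ for all $B$ in its domain; $\varphi$ is called a settling bijection for $s$. Let $\ell(\mathcal C,\mathcal C_T)$ be the largest item size of $\mathcal C$ that is not settled in $\mathcal C$, and $0$ if all item sizes are settled. **Theorem.** Let $\kappa$ be a power of $2$ (powers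 of $2$ include $1$), and let $\mathcal C_S,\mathcal C_T$ be legal configurations for capacity $\kappa$ with the same number of bunches and with the same multiset $U$ of all items, where all items in $U$ are powers of $2$. Then $\mathcal C_S$ can be reconfigured to $\mathcal C_T$ if and only if $$\sum_{B\in\mathcal C_S}\mathrm{slack}(B)\ \ge\ \ell(\mathcal C_S,\mathcal C_T).$$ Moreover, whenever $\mathcal C_S$ can be reconfigured to $\mathcal C_T$, every execution of the following nondeterministic algorithm SettleItems, whatever choices it makes, can carry out all its instructions, terminates after finitely many steps, and moves items one at a time in such a way that the configurations met, with immediate repetitions deleted, form a reconfiguration sequence from $\mathcal C_S$ to $\mathcal C_T$. *Algorithm SettleItems.* The slack items of a bunch $B$ are the distinct powers of $2$ with sum $\mathrm{slack}(B)$, and $\mathrm{All}(B)$ is the multiset of the (actual) items and the slack items of $B$. A bundle is a multiset of elements of $\mathrm{All}(B)$. A move from a bunch to itself does nothing. Bunches keep their identity when items are moved. The procedure Form-Bundles$(B,p)$, applied where $p<\log_2\kappa$ and some element of $\mathrm{All}(B)$ is at most $2^p$, starts with one bundle for each element of $\mathrm{All}(B)$; for $j=0,\dots,p-1$, as long as there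 are two bundles with sum $2^j$, it merges two such bundles; finally it returns two arbitrary bundles with sum $2^p$. Let $u_1>\dots>u_k$ be the distinct sizes in $U$. For $i=1,\dots,k$, let $\mathcal C$ be the configuration at the start of stage $i$. If $\ell(\mathcal C,\mathcal C_T)<u_i$, go to the next stage. Otherwise: 1. (Mapping) Let $\varphi$ be a settling bijection for $u_{i-1}$ in $\mathcal C$ (the empty map if $i=1$). Let $\mathcal C'$ and $\mathcal C_T'$ consist of the bunches of $\mathcal C$ and of $\mathcal C_T$, respectively, whose largest item has size $u_i$. Enlarge the smaller of the two by bunches (of $\mathcal C$ or of $\mathcal C_T$, respectively) all of whose items are smaller than $u_i$ until both have the same number of bunches, and extend $\varphi$ by an arbitrary bijection $\mathcal C'\to\mathcal C_T'$. 2. (Action) While some $B$ in the domain of $\varphi$ has a different number of items of size $u_i$ than $\varphi(B)$, choose $B_s$ and $B_d$ in the domain such that $B_s$ has more, and $B_d$ fewer, items of size $u_i$ than its image, and do the following. - (Compression) While there are two bunches $B_1,B_2$ and some $q<\log_2 u_i$ such that both have a slack item of size $2^q$, choose such $B_1,B_2,q$, apply Form-Bundles$(B_1,q)$, and move to $B_2$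 the actual items of the first of the two bundles if it has any, and otherwise those of the second. - (Transfer) Choose a bunch $B_{\mathrm{temp}}$ with a slack item of size at least $u_i$. If $\mathrm{slack}(B_d)\ge u_i$, move an item of size $u_i$ from $B_s$ to $B_d$. Otherwise, move an item of size $u_i$ from $B_s$ to $B_{\mathrm{temp}}$, apply Form-Bundles$(B_d,\log_2(u_i/2))$, move all actual items of the two bundles from $B_d$ to $B_s$, and move an item of size $u_i$ from $B_{\mathrm{temp}}$ to $B_d$. -/

import Mathlib

/-! ## Bunches, configurations and reconfiguration

An item is identified with its size, a bunch is a multiset of items, and a configuration is a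
multiset of bunches. -/

namespace Repacking

abbrev Bunch := Multiset ℕ

abbrev Config := Multiset Bunch

/-- The volume of a bunch. -/
def vol (B : Bunch) : ℕ := B.sum

/-- The slack of a bunch (only used for bunches of volume at most `κ`). -/
def slack (κ : ℕ) (B : Bunch) : ℕ := κ - vol B

/-- Legal configuration for capacity `κ`. -/
def IsLegal (κ : ℕ) (C : Config) : Prop := ∀ B ∈ C, vol B ≤ κ

/-- The multiset union of the items of all bunches of a configuration. -/
def underlying (C : Config) : Multiset ℕ := C.join

def totalSlack (κ : ℕ) (C : Config) : ℕ := (C.map (slack κ)).sum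

/-- The pair of old bunches `(Bd, Br)` and the pair of new bunches `(Bd₁, Br₁)` correspond to the
move of a single item from the donor bunch to the recipient bunch. -/
def IsItemMove (Bd Br Bd₁ Br₁ : Bunch) : Prop :=
  ∃ u ∈ Bd, Bd₁ = Bd.erase u ∧ Br₁ = u ::ₘ Br

/-- Adjacent configurations for capacity `κ`. -/
def Adjacent (κ : ℕ) (C D : Config) : Prop :=
  IsLegal κ C ∧ IsLegal κ D ∧
    ∃ Bd Br Bd₁ Br₁ : Bunch, C - D = {Bd, Br} ∧ D - C = {Bd₁, Br₁} ∧ IsItemMove Bd Br Bd₁ Br₁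

/-- `L` is a reconfiguration sequence for capacity `κ` from `CS` to `CT`. -/
def IsReconfSeq (κ : ℕ) (CS CT : Config) (L : List Config) : Prop :=
  L.head? = some CS ∧ L.getLast? = some CT ∧ (∀ C ∈ L, IsLegal κ C) ∧ L.IsChain (Adjacent κ)

/-- `CS` can be reconfigured to `CT`. -/
def Reconfigurable (κ : ℕ) (CS CT : Config) : Prop := ∃ L : List Config, IsReconfSeq κ CS CT L

/-! ## Settled item sizes -/

/-- The multiset of items of `B` of size at least `s`. -/
def atLeast (s : ℕ) (B : Bunch) : Multiset ℕ := B.filter (fun u => s ≤ u)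

open Classical in
/-- Item size `s` is settled in `C` (with respect to the target `CT`): there is a bijection between
the bunches of `C` and the bunches of `CT` that contain an item of size at least `s`, such that
corresponding bunches have the same items of size at least `s`.  (`Multiset.Rel` is the existence of
a bijection between the occurrences in two multisets, with corresponding elements related.) -/
def Settled (s : ℕ) (C CT : Config) : Prop :=
  Multiset.Rel (fun B D => atLeast s B = atLeast s D)
    (C.filter (fun B => ∃ u ∈ B, s ≤ u)) (CT.filter (fun D => ∃ u ∈ D, s ≤ u))

open Classical in
/-- The largest item size that is not settled in `C`; it is `0` if every item size is settled. -/
noncomputable def largestUnsettled (C CT : Config) : ℕ :=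
  ((underlying C).toFinset.filter (fun u => ¬ Settled u C CT)).sup id

/-! ## The algorithm SettleItems

The algorithm leaves many choices open, so it is given as a nondeterministic transition system.
The `n` bunches of the current configuration and those of the target are named by `Fin n`. -/

namespace SettleItems

/-- The configuration formed by named bunches. -/
def config {n : ℕ} (B : Fin n → Bunch) : Config := (Finset.univ : Finset (Fin n)).val.map B

/-- The distinct item sizes of a configuration, in decreasing order. -/
def sizes (C : Config) : List ℕ := (underlying C).toFinset.sort (fun a b => b ≤ a)

/-- The `i`th largest item size (counted from `0`) of the target, which has the same items as each
configuration that is met. -/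
def itemSize {n : ℕ} (T : Fin n → Bunch) (i : ℕ) : ℕ := (sizes (config T)).getD i 0

/-- The number of distinct item sizes, that is, the number of stages. -/
def numStages {n : ℕ} (T : Fin n → Bunch) : ℕ := (sizes (config T)).length

/-! ### Slack items and bundles -/

/-- The slack items of a bunch: the distinct powers of 2 with sum equal to its slack. -/
def slackItems (κ : ℕ) (B : Bunch) : Multiset ℕ :=
  ((slack κ B).bitIndices.map (fun q => 2 ^ q) : List ℕ)

/-- Actual items and slack items. -/
inductive Elem where
  | actual (u : ℕ) : Elem
  | slack (u : ℕ) : Elem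

def Elem.size : Elem → ℕ
  | .actual u => u
  | .slack u => u

def Elem.actual? : Elem → Option ℕ
  | .actual u => some u
  | .slack _ => none

abbrev Bundle := Multiset Elem

/-- The multiset of the actual and the slack items of a bunch. -/
def allElems (κ : ℕ) (B : Bunch) : Multiset Elem :=
  B.map Elem.actual + (slackItems κ B).map Elem.slack

def bsum (b : Bundle) : ℕ := (b.map Elem.size).sum

/-- The actual items in a bundle. -/
def actualItems (b : Bundle) : Multiset ℕ := b.filterMap Elem.actual?

/-- The inputs `B`, `p` for which bundles are formed: `p < log₂ κ`, and some actual or slack item of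
`B` has size at most `2 ^ p`. -/
def BundleInput (κ : ℕ) (B : Bunch) (p : ℕ) : Prop :=
  p < Nat.log 2 κ ∧ ∃ e ∈ allElems κ B, e.size ≤ 2 ^ p

/-- The initial list of bundles: one for each actual or slack item. -/
def initBundles (κ : ℕ) (B : Bunch) : Multiset Bundle := (allElems κ B).map (fun e => {e})

/-! ### The Mapping Step -/

/-- `φ` is a settling bijection for size `s` from the bunches `B` to the bunches `T`. -/
def IsSettling {n : ℕ} (s : ℕ) (B T : Fin n → Bunch) (φ : Fin n ≃. Fin n) : Prop :=
  (∀ x, (∃ y, y ∈ φ x) ↔ ∃ u ∈ B x, s ≤ u) ∧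
  (∀ y, (∃ x, y ∈ φ x) ↔ ∃ u ∈ T y, s ≤ u) ∧
  ∀ x y, y ∈ φ x → atLeast s (B x) = atLeast s (T y)

/-- The initial mapping of stage `i`: empty in the first stage, and a settling bijection for the
previous item size in each later stage. -/
def IsInitialMap {n : ℕ} (B T : Fin n → Bunch) : ℕ → (Fin n ≃. Fin n) → Prop
  | 0, φ => φ = ⊥
  | i + 1, φ => IsSettling (itemSize T i) B T φ

/-- The largest item of `B` has size `u`. -/
def HasLargest (u : ℕ) (B : Bunch) : Prop := u ∈ B ∧ ∀ v ∈ B, v ≤ u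

open Classical in
/-- The named bunches whose largest item has size `u`. -/
noncomputable def withLargest {n : ℕ} (u : ℕ) (B : Fin n → Bunch) : Finset (Fin n) :=
  Finset.univ.filter (fun x => HasLargest u (B x))

/-- `X` consists of the bunches with largest item of size `u`, together with bunches with
all items smaller than `u` that bring the number of bunches up to `m`. -/
def IsPadding {n : ℕ} (u : ℕ) (B : Fin n → Bunch) (m : ℕ) (X : Finset (Fin n)) : Prop :=
  withLargest u B ⊆ X ∧ (∀ x ∈ X, x ∉ withLargest u B → ∀ v ∈ B x, v < u) ∧ X.card = m

/-- `φ` may be chosen in the Mapping Step of stage `i`: an initial mapping `φ₀` is extended by an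
arbitrary bijection `ψ` between the bunches with largest item of size `u`, where the smaller of the
two families is first padded to the size of the other. -/
def IsStageMap {n : ℕ} (B T : Fin n → Bunch) (i : ℕ) (φ : Fin n ≃. Fin n) : Prop :=
  ∃ (φ₀ ψ : Fin n ≃. Fin n) (X Y : Finset (Fin n)),
    IsInitialMap B T i φ₀ ∧
    IsPadding (itemSize T i) B
      (max (withLargest (itemSize T i) B).card (withLargest (itemSize T i) T).card) X ∧
    IsPadding (itemSize T i) T
      (max (withLargest (itemSize T i) B).card (withLargest (itemSize T i) T).card) Y ∧
    (∀ x, (∃ y, y ∈ ψ x) ↔ x ∈ X) ∧ (∀ y, (∃ x, y ∈ ψ x) ↔ y ∈ Y) ∧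
    ∀ x y, y ∈ φ x ↔ y ∈ φ₀ x ∨ y ∈ ψ x

/-! ### States and transitions -/

/-- The instruction to move an item from the bunch `src` to the bunch `dst`. -/
structure Move (n : ℕ) where
  item : ℕ
  src : Fin n
  dst : Fin n

/-- What the bundles are formed for: to move a bundle to `y` in order to merge slack items, or
to transfer an item with the bunch `t` as its temporary host. -/
inductive Goal (n : ℕ) where
  | mergeInto (y : Fin n) : Goal n
  | transfer (t : Fin n) : Goal n

/-- The point of the program that has been reached, with the values of the local variables: the
mapping `φ` of the stage, the surplus bunch `s`, the deficit bunch `d`, the temporary host `t`;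
and, while bundles of the bunch `x` with sum `2 ^ p` are formed, the loop index `j` and the current
bundles `L`. -/
inductive Phase (n : ℕ) where
  | stage : Phase n
  | action (φ : Fin n ≃. Fin n) : Phase n
  | compress (φ : Fin n ≃. Fin n) (s d : Fin n) : Phase n
  | transfer (φ : Fin n ≃. Fin n) (s d t : Fin n) : Phase n
  | bundles (φ : Fin n ≃. Fin n) (s d : Fin n) (x : Fin n) (p j : ℕ) (L : Multiset Bundle)
      (g : Goal n) : Phase n

/-- A state: the current bunches, the moves that are to be made before the program goes on, the
current stage (counted from `0`), and the point of the program. -/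
structure State (n : ℕ) where
  bunch : Fin n → Bunch
  todo : List (Move n)
  index : ℕ
  phase : Phase n

/-- The bunches after an item `u` has been moved from `x` to `y`, where `x ≠ y`. -/
def moveItem {n : ℕ} (B : Fin n → Bunch) (u : ℕ) (x y : Fin n) : Fin n → Bunch :=
  Function.update (Function.update B x ((B x).erase u)) y (u ::ₘ B y)

/-- Slack items of size `2 ^ q`, smaller than `u`, can be merged from the bunches `x` and `y`. -/
def Mergeable {n : ℕ} (κ : ℕ) (B : Fin n → Bunch) (u : ℕ) (x y : Fin n) (q : ℕ) : Prop :=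
  x ≠ y ∧ q < Nat.log 2 u ∧ 2 ^ q ∈ slackItems κ (B x) ∧ 2 ^ q ∈ slackItems κ (B y)

/-- The transitions of the algorithm for capacity `κ` and target bunches `T`.  A move of
an item is possible only if the item is in the donor bunch and fits into the recipient bunch; a move
from a bunch to itself does nothing.  If an instruction cannot be carried out, then the state has no
successor. -/
inductive Step {n : ℕ} (κ : ℕ) (T : Fin n → Bunch) : State n → State n → Prop
  /-- Move one item. -/
  | move (B : Fin n → Bunch) (u : ℕ) (x y : Fin n) (ms : List (Move n)) (i : ℕ) (ph : Phase n)
      (hxy : x ≠ y) (hu : u ∈ B x) (hfit : u ≤ slack κ (B y)) :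
      Step κ T ⟨B, ⟨u, x, y⟩ :: ms, i, ph⟩ ⟨moveItem B u x y, ms, i, ph⟩
  | moveSelf (B : Fin n → Bunch) (u : ℕ) (x : Fin n) (ms : List (Move n)) (i : ℕ) (ph : Phase n)
      (hu : u ∈ B x) :
      Step κ T ⟨B, ⟨u, x, x⟩ :: ms, i, ph⟩ ⟨B, ms, i, ph⟩
  /-- Mapping Step: skip the stage. -/
  | skip (B : Fin n → Bunch) (i : ℕ) (hi : i < numStages T)
      (hl : largestUnsettled (config B) (config T) < itemSize T i) :
      Step κ T ⟨B, [], i, .stage⟩ ⟨B, [], i + 1, .stage⟩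
  /-- Mapping Step: choose the mapping. -/
  | choose (B : Fin n → Bunch) (i : ℕ) (φ : Fin n ≃. Fin n) (hi : i < numStages T)
      (hl : ¬ largestUnsettled (config B) (config T) < itemSize T i)
      (hφ : IsStageMap B T i φ) :
      Step κ T ⟨B, [], i, .stage⟩ ⟨B, [], i, .action φ⟩
  /-- Action Step: the stage is complete. -/
  | actionExit (B : Fin n → Bunch) (i : ℕ) (φ : Fin n ≃. Fin n)
      (h : ∀ x y, y ∈ φ x → (B x).count (itemSize T i) = (T y).count (itemSize T i)) :
      Step κ T ⟨B, [], i, .action φ⟩ ⟨B, [], i + 1, .stage⟩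
  /-- Action Step: choose a surplus bunch and a deficit bunch. -/
  | actionEnter (B : Fin n → Bunch) (i : ℕ) (φ : Fin n ≃. Fin n) (s d s₁ d₁ : Fin n)
      (hs : s₁ ∈ φ s) (hs' : (T s₁).count (itemSize T i) < (B s).count (itemSize T i))
      (hd : d₁ ∈ φ d) (hd' : (B d).count (itemSize T i) < (T d₁).count (itemSize T i)) :
      Step κ T ⟨B, [], i, .action φ⟩ ⟨B, [], i, .compress φ s d⟩
  /-- Compression phase: start to merge two slack items. -/
  | mergeStart (B : Fin n → Bunch) (i : ℕ) (φ : Fin n ≃. Fin n) (s d x y : Fin n) (q : ℕ)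
      (h : Mergeable κ B (itemSize T i) x y q) (hin : BundleInput κ (B x) q) :
      Step κ T ⟨B, [], i, .compress φ s d⟩
        ⟨B, [], i, .bundles φ s d x q 0 (initBundles κ (B x)) (.mergeInto y)⟩
  /-- Transfer phase, direct: `t` is the (unused) temporary host. -/
  | direct (B : Fin n → Bunch) (i : ℕ) (φ : Fin n ≃. Fin n) (s d t : Fin n)
      (h : ∀ x y q, ¬ Mergeable κ B (itemSize T i) x y q)
      (ht : ∃ v ∈ slackItems κ (B t), itemSize T i ≤ v)
      (hd : itemSize T i ≤ slack κ (B d)) :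
      Step κ T ⟨B, [], i, .compress φ s d⟩ ⟨B, [⟨itemSize T i, s, d⟩], i, .action φ⟩
  /-- Transfer phase, first move: from the surplus bunch to the temporary host. -/
  | toTemp (B : Fin n → Bunch) (i : ℕ) (φ : Fin n ≃. Fin n) (s d t : Fin n)
      (h : ∀ x y q, ¬ Mergeable κ B (itemSize T i) x y q)
      (ht : ∃ v ∈ slackItems κ (B t), itemSize T i ≤ v)
      (hd : ¬ itemSize T i ≤ slack κ (B d)) :
      Step κ T ⟨B, [], i, .compress φ s d⟩ ⟨B, [⟨itemSize T i, s, t⟩], i, .transfer φ s d t⟩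
  /-- Transfer phase: start to form bundles in the deficit bunch, with `p = log₂ (u / 2)` for the
  current item size `u`. -/
  | transferStart (B : Fin n → Bunch) (i : ℕ) (φ : Fin n ≃. Fin n) (s d t : Fin n) (p : ℕ)
      (hp : 2 ^ (p + 1) = itemSize T i) (hin : BundleInput κ (B d) p) :
      Step κ T ⟨B, [], i, .transfer φ s d t⟩
        ⟨B, [], i, .bundles φ s d d p 0 (initBundles κ (B d)) (.transfer t)⟩
  /-- Forming bundles: merge two bundles with sum `2 ^ j`. -/
  | bundleMerge (B : Fin n → Bunch) (i : ℕ) (φ : Fin n ≃. Fin n) (s d x : Fin n) (p j : ℕ)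
      (b₁ b₂ : Bundle) (R : Multiset Bundle) (g : Goal n)
      (hj : j < p) (h₁ : bsum b₁ = 2 ^ j) (h₂ : bsum b₂ = 2 ^ j) :
      Step κ T ⟨B, [], i, .bundles φ s d x p j (b₁ ::ₘ b₂ ::ₘ R) g⟩
        ⟨B, [], i, .bundles φ s d x p j ((b₁ + b₂) ::ₘ R) g⟩
  /-- Forming bundles: no two bundles with sum `2 ^ j` are left. -/
  | bundleNext (B : Fin n → Bunch) (i : ℕ) (φ : Fin n ≃. Fin n) (s d x : Fin n) (p j : ℕ)
      (L : Multiset Bundle) (g : Goal n) (hj : j < p)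
      (h : ¬ ∃ (b₁ b₂ : Bundle) (R : Multiset Bundle),
        L = b₁ ::ₘ b₂ ::ₘ R ∧ bsum b₁ = 2 ^ j ∧ bsum b₂ = 2 ^ j) :
      Step κ T ⟨B, [], i, .bundles φ s d x p j L g⟩ ⟨B, [], i, .bundles φ s d x p (j + 1) L g⟩
  /-- Compression phase: any two bundles with sum `2 ^ p` are chosen, and the actual items of
  one of them are moved from `x` to `y`, one by one in any order. -/
  | mergeMoves (B : Fin n → Bunch) (i : ℕ) (φ : Fin n ≃. Fin n) (s d x y : Fin n) (p : ℕ)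
      (b₁ b₂ : Bundle) (R : Multiset Bundle) (l : List ℕ)
      (h₁ : bsum b₁ = 2 ^ p) (h₂ : bsum b₂ = 2 ^ p)
      (hl : (l : Multiset ℕ) = if actualItems b₁ ≠ 0 then actualItems b₁ else actualItems b₂) :
      Step κ T ⟨B, [], i, .bundles φ s d x p p (b₁ ::ₘ b₂ ::ₘ R) (.mergeInto y)⟩
        ⟨B, l.map (fun v => ⟨v, x, y⟩), i, .compress φ s d⟩
  /-- Transfer phase: any two bundles with sum `2 ^ p` are chosen, their actual items are moved from
  the deficit bunch to the surplus bunch, one by one in any order, and then an item of the current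
  size is moved from the temporary host to the deficit bunch. -/
  | transferMoves (B : Fin n → Bunch) (i : ℕ) (φ : Fin n ≃. Fin n) (s d x t : Fin n) (p : ℕ)
      (b₁ b₂ : Bundle) (R : Multiset Bundle) (l : List ℕ)
      (h₁ : bsum b₁ = 2 ^ p) (h₂ : bsum b₂ = 2 ^ p)
      (hl : (l : Multiset ℕ) = actualItems b₁ + actualItems b₂) :
      Step κ T ⟨B, [], i, .bundles φ s d x p p (b₁ ::ₘ b₂ ::ₘ R) (.transfer t)⟩
        ⟨B, l.map (fun v => ⟨v, d, s⟩) ++ [⟨itemSize T i, t, d⟩], i, .action φ⟩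

/-- The initial state for source bunches `S`. -/
def init {n : ℕ} (S : Fin n → Bunch) : State n := ⟨S, [], 0, .stage⟩

/-- The algorithm has terminated regularly: all stages are complete. -/
def IsFinal {n : ℕ} (T : Fin n → Bunch) (σ : State n) : Prop :=
  σ.todo = [] ∧ σ.phase = .stage ∧ σ.index = numStages T

/-- `E` is a finite execution from the initial state that cannot be continued. -/
def IsMaximalExecution {n : ℕ} (κ : ℕ) (S T : Fin n → Bunch) (E : List (State n)) : Prop :=
  E.head? = some (init S) ∧ E.IsChain (Step κ T) ∧ ∀ σ, E.getLast? = some σ → ∀ τ, ¬ Step κ T σ τ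

/-- The algorithm produces a reconfiguration sequence from `CS` to `CT`, whatever names the bunches
have and whatever choices it makes: there is no infinite execution; and each execution that
cannot be continued has completed all stages, and the configurations that it goes through, with
immediate repetitions deleted, form a reconfiguration sequence from `CS` to `CT`. -/
def Solves (κ : ℕ) (CS CT : Config) : Prop :=
  ∀ (n : ℕ) (S T : Fin n → Bunch), config S = CS → config T = CT →
    (¬ ∃ f : ℕ → State n, f 0 = init S ∧ ∀ k, Step κ T (f k) (f (k + 1))) ∧
    ∀ E : List (State n), IsMaximalExecution κ S T E →
      (∃ σ, E.getLast? = some σ ∧ IsFinal T σ) ∧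
      IsReconfSeq κ CS CT ((E.map (fun σ => config σ.bunch)).destutter (fun C D => C ≠ D))

end SettleItems

end Repacking

namespace Repacking

namespace SettleItems

/-! ### Powers of two -/

/-! Necessity. A move keeps the number of bunches and the items, so the total slack is constant. The
moved item fits into the slack of its recipient, so an item larger than the total slack never moves.
For `s` above the total slack, the multiset of large parts of bunches (`profile`) is therefore
invariant; since `s` is settled exactly when source and target have equal profiles, it must be
settled from the start.

Sufficiency. Let `K` be the total slack, and suppose that the sizes above the current size `u ≤ K`
are settled. Then `φ` matches bunches with the same items above `u`, and covers all items of size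
`u`. Each passage through the loop of a stage moves one item of size `u` from a surplus to a deficit
bunch in exchange for items smaller than `u`, so the larger items stay matched and the total deficit
drops by one. Three facts make this possible.

Bundling: the actual and slack items of a bunch are powers of two with sum `κ = 2 ^ a`. When no sum
below `2 ^ p` occurs twice, parity rules out all smaller sums, and forces an even, positive number
of bundles with sum `2 ^ p` (`two_le_count_two_pow`).

Compression: the binary expansion is the shortest sum of powers of two. Hence two bundles with the
same sum are not both pure slack, and a merge strictly decreases the number of slack items
(`card_slackItems_lt_of_move`). When no merge is possible, slack items below `u` are distinct over
all bunches; were there no others, the total slack would be less than `u` (`sum_slack_lt`). So a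
temporary host exists.

Transfer: a deficit bunch with slack below `u` has an actual or slack item below `u`, as otherwise
it would be full and its image would exceed the capacity (`PairInv.exists_small`). Thus it yields
two bundles with sum `u / 2`. Vacating them makes room for `u`, and their actual items fit where `u`
has left.

For arbitrary choices, these facts are packed into an invariant of states with a lexicographic rank.
Every step preserves the invariant and lowers the rank, every non-final state has a successor, and
in a final state the smallest size is settled, which determines the configuration. -/

theorem length_bitIndices_add_two_pow_le (k x : ℕ) :
    (x + 2 ^ k).bitIndices.length ≤ x.bitIndices.length + 1 := by
  induction k generalizing x with
  | zero =>
    induction x using Nat.strong_induction_on with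
    | _ x ih =>
      obtain ⟨y, rfl | rfl⟩ := Nat.even_or_odd' x
      · simp
      -- Adding 1 to an odd number loses the lowest bit and carries into the half, which strong
      -- induction handles.
      · have h : 2 * y + 1 + 2 ^ 0 = 2 * (y + 1) := by ring
        have := ih y (by omega)
        rw [h, Nat.bitIndices_two_mul, Nat.bitIndices_two_mul_add_one]
        simp only [List.length_map, List.length_cons]
        simpa using Nat.le_succ_of_le this
  | succ k ih =>
    obtain ⟨y, rfl | rfl⟩ := Nat.even_or_odd' x
    · have h : 2 * y + 2 ^ (k + 1) = 2 * (y + 2 ^ k) := by ring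
      rw [h, Nat.bitIndices_two_mul, Nat.bitIndices_two_mul]
      simpa using ih y
    · have h : 2 * y + 1 + 2 ^ (k + 1) = 2 * (y + 2 ^ k) + 1 := by ring
      rw [h, Nat.bitIndices_two_mul_add_one, Nat.bitIndices_two_mul_add_one]
      simpa using ih y

/-- The binary expansion is a shortest representation as a sum of powers of two. -/
theorem length_bitIndices_sum_le (M : Multiset ℕ) (hM : ∀ v ∈ M, ∃ k, v = 2 ^ k) :
    M.sum.bitIndices.length ≤ M.card := by
  induction M using Multiset.induction_on with
  | empty => simp
  | cons v M ih =>
    obtain ⟨k, rfl⟩ := hM v (Multiset.mem_cons_self _ _)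
    have h := length_bitIndices_add_two_pow_le k M.sum
    have := ih fun w hw => hM w (Multiset.mem_cons_of_mem hw)
    rw [Multiset.sum_cons, Multiset.card_cons, add_comm]
    omega

/-- Modulo `2 ^ (j + 1)` only the terms equal to `2 ^ j` survive. -/
theorem even_count_two_pow (S : Multiset ℕ) (j : ℕ) (h : ∀ v ∈ S, ∃ k, v = 2 ^ k ∧ j ≤ k)
    (hS : 2 ^ (j + 1) ∣ S.sum) : Even (S.count (2 ^ j)) := by
  -- Counting each term `2 ^ j` twice makes every term divisible by `2 ^ (j + 1)`.
  have key : 2 ^ (j + 1) ∣ S.sum + S.count (2 ^ j) * 2 ^ j := by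
    clear hS
    induction S using Multiset.induction_on with
    | empty => simp
    | cons v S ih =>
      have ih := ih fun w hw => h w (Multiset.mem_cons_of_mem hw)
      obtain ⟨k, rfl, hk⟩ := h v (Multiset.mem_cons_self _ _)
      rw [Multiset.sum_cons]
      rcases hk.eq_or_lt with rfl | hk
      · rw [Multiset.count_cons_self]
        have : 2 ^ j + S.sum + (S.count (2 ^ j) + 1) * 2 ^ j
            = 2 ^ (j + 1) + (S.sum + S.count (2 ^ j) * 2 ^ j) := by ring
        rw [this]
        exact dvd_add dvd_rfl ih
      · have hne : 2 ^ j ≠ 2 ^ k := fun h => hk.ne (Nat.pow_right_injective le_rfl h)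
        rw [Multiset.count_cons_of_ne hne, add_assoc]
        exact dvd_add (pow_dvd_pow 2 hk) ih
  have h2 := (Nat.dvd_add_right hS).1 key
  rw [pow_succ, mul_comm (S.count _)] at h2
  exact even_iff_two_dvd.2 (Nat.dvd_of_mul_dvd_mul_left (Nat.two_pow_pos j) h2)

/-- Going upwards from `2 ^ 0`, each multiplicity below `p` is even and at most 1, hence 0. The
multiplicity of `2 ^ p` is then even too, because `p < a`, and the small element can only be `2 ^ p`
itself. -/
theorem two_le_count_two_pow (S : Multiset ℕ) {p a : ℕ} (hpa : p < a) (hS : S.sum = 2 ^ a)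
    (hpow : ∀ v ∈ S, ∃ k, v = 2 ^ k) (hsmall : ∃ v ∈ S, v ≤ 2 ^ p)
    (hone : ∀ k < p, S.count (2 ^ k) ≤ 1) : 2 ≤ S.count (2 ^ p) := by
  have key : ∀ j ≤ p, ∀ v ∈ S, ∃ k, v = 2 ^ k ∧ j ≤ k := by
    intro j
    induction j with
    | zero => intro _ v hv; obtain ⟨k, rfl⟩ := hpow v hv; exact ⟨k, rfl, Nat.zero_le _⟩
    | succ j ih =>
      intro hj v hv
      have hge := ih (by omega)
      obtain ⟨r, hr⟩ := even_count_two_pow S j hge (hS ▸ pow_dvd_pow 2 (by omega))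
      have := hone j (by omega)
      have h0 : S.count (2 ^ j) = 0 := by omega
      obtain ⟨k, rfl, hk⟩ := hge v hv
      refine ⟨k, rfl, ?_⟩
      rcases hk.eq_or_lt with rfl | hk
      · exact absurd hv (Multiset.count_eq_zero.1 h0)
      · exact hk
  obtain ⟨r, hr⟩ := even_count_two_pow S p (key p le_rfl) (hS ▸ pow_dvd_pow 2 (by omega))
  obtain ⟨v, hv, hvp⟩ := hsmall
  obtain ⟨k, rfl, hk⟩ := key p le_rfl v hv
  have : k = p := le_antisymm ((Nat.pow_le_pow_iff_right (by norm_num)).1 hvp) hk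
  subst this
  have := Multiset.count_pos.2 hv
  omega

/-! ### Slack items -/

theorem sum_slackItems (κ : ℕ) (B : Bunch) : (slackItems κ B).sum = slack κ B := by
  simp [slackItems]

theorem slackItems_pow {κ : ℕ} {B : Bunch} {v : ℕ} (hv : v ∈ slackItems κ B) : ∃ k, v = 2 ^ k := by
  simp only [slackItems, Multiset.mem_coe, List.mem_map] at hv
  obtain ⟨k, -, rfl⟩ := hv
  exact ⟨k, rfl⟩

theorem card_slackItems (κ : ℕ) (B : Bunch) :
    (slackItems κ B).card = (slack κ B).bitIndices.length := by
  simp [slackItems]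

theorem card_slackItems_le {κ : ℕ} {B : Bunch} (M : Multiset ℕ) (hM : ∀ v ∈ M, ∃ k, v = 2 ^ k)
    (h : M.sum = slack κ B) : (slackItems κ B).card ≤ M.card := by
  rw [card_slackItems, ← h]
  exact length_bitIndices_sum_le M hM

theorem le_slack_of_mem_slackItems {κ : ℕ} {B : Bunch} {v : ℕ} (hv : v ∈ slackItems κ B) :
    v ≤ slack κ B :=
  sum_slackItems κ B ▸ Multiset.le_sum_of_mem hv

theorem two_pow_mem_slackItems {κ : ℕ} {B : Bunch} {q : ℕ} :
    2 ^ q ∈ slackItems κ B ↔ q ∈ (slack κ B).bitIndices := by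
  simp only [slackItems, Multiset.mem_coe, List.mem_map]
  constructor
  · rintro ⟨k, hk, h⟩
    rwa [← Nat.pow_right_injective le_rfl h]
  · exact fun h => ⟨q, h, rfl⟩

/-- If no two bunches share a slack item below `2 ^ k` and there is no larger slack item, then the
slack is less than `2 ^ k`. -/
theorem sum_slack_lt {n κ k : ℕ} (B : Fin n → Bunch)
    (h : ∀ x y q, ¬ Mergeable κ B (2 ^ k) x y q)
    (hlt : ∀ x, ∀ v ∈ slackItems κ (B x), v < 2 ^ k) : ∑ x, slack κ (B x) < 2 ^ k := by
  have hb : ∀ x, ∀ q ∈ (slack κ (B x)).bitIndices.toFinset, q < k := by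
    intro x q hq
    have := hlt x (2 ^ q) (two_pow_mem_slackItems.2 (List.mem_toFinset.1 hq))
    exact (Nat.pow_lt_pow_iff_right (by norm_num)).1 this
  have h1 : ∑ x, slack κ (B x) = ∑ x, ∑ q ∈ (slack κ (B x)).bitIndices.toFinset, 2 ^ q :=
    Finset.sum_congr rfl fun x _ => (Finset.sum_toFinset_bitIndices_two_pow _).symm
  -- Unmergeability makes the exponent sets of different bunches disjoint, so the total is a sum of
  -- distinct powers of two below `2 ^ k`.
  rw [h1, ← Finset.sum_biUnion]
  · refine Nat.geomSum_lt le_rfl fun q hq => ?_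
    obtain ⟨x, -, hx⟩ := Finset.mem_biUnion.1 hq
    exact hb x q hx
  · intro x _ y _ hxy
    rw [Function.onFun, Finset.disjoint_left]
    intro q hx hy
    refine h x y q ⟨hxy, ?_, two_pow_mem_slackItems.2 (List.mem_toFinset.1 hx),
      two_pow_mem_slackItems.2 (List.mem_toFinset.1 hy)⟩
    rw [Nat.log_pow (by norm_num)]
    exact hb x q hx

/-! ### Bundles -/

/-- The slack items in a bundle. -/
def Elem.slack? : Elem → Option ℕ
  | .actual _ => none
  | .slack u => some u

def slackPart (b : Bundle) : Multiset ℕ := b.filterMap Elem.slack?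

theorem bsum_add (b c : Bundle) : bsum (b + c) = bsum b + bsum c := by simp [bsum]

theorem actualItems_add (b c : Bundle) : actualItems (b + c) = actualItems b + actualItems c :=
  Multiset.filterMap_add ..

theorem slackPart_add (b c : Bundle) : slackPart (b + c) = slackPart b + slackPart c :=
  Multiset.filterMap_add ..

theorem bsum_eq (b : Bundle) : bsum b = (actualItems b).sum + (slackPart b).sum := by
  induction b using Multiset.induction_on with
  | empty => rfl
  | cons e b ih =>
    rw [bsum, Multiset.map_cons, Multiset.sum_cons, ← bsum, ih]
    cases e with
    | actual u =>
      have h1 : actualItems (.actual u ::ₘ b) = u ::ₘ actualItems b :=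
        Multiset.filterMap_cons_some _ _ _ rfl
      have h2 : slackPart (.actual u ::ₘ b) = slackPart b := Multiset.filterMap_cons_none _ _ rfl
      rw [h1, h2, Multiset.sum_cons, add_assoc]
      rfl
    | slack u =>
      have h1 : actualItems (.slack u ::ₘ b) = actualItems b := Multiset.filterMap_cons_none _ _ rfl
      have h2 : slackPart (.slack u ::ₘ b) = u ::ₘ slackPart b :=
        Multiset.filterMap_cons_some _ _ _ rfl
      rw [h1, h2, Multiset.sum_cons, add_left_comm]
      rfl

theorem actualItems_allElems (κ : ℕ) (B : Bunch) : actualItems (allElems κ B) = B := by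
  rw [allElems, actualItems_add, actualItems, actualItems, Multiset.filterMap_map,
    Multiset.filterMap_map]
  have h1 : (Elem.actual? ∘ Elem.actual) = some := rfl
  have h2 : (Elem.actual? ∘ Elem.slack) = fun _ => none := rfl
  rw [h1, h2, Multiset.filterMap_some]
  induction slackItems κ B using Multiset.induction_on <;> simp_all

theorem slackPart_allElems (κ : ℕ) (B : Bunch) : slackPart (allElems κ B) = slackItems κ B := by
  rw [allElems, slackPart_add, slackPart, slackPart, Multiset.filterMap_map,
    Multiset.filterMap_map]
  have h1 : (Elem.slack? ∘ Elem.actual) = fun _ => none := rfl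
  have h2 : (Elem.slack? ∘ Elem.slack) = some := rfl
  rw [h1, h2, Multiset.filterMap_some]
  induction B using Multiset.induction_on <;> simp_all

theorem actualItems_le {κ : ℕ} {B : Bunch} {b : Bundle} (h : b ≤ allElems κ B) :
    actualItems b ≤ B :=
  actualItems_allElems κ B ▸ Multiset.filterMap_le_filterMap _ h

theorem slackPart_le {κ : ℕ} {B : Bunch} {b : Bundle} (h : b ≤ allElems κ B) :
    slackPart b ≤ slackItems κ B :=
  slackPart_allElems κ B ▸ Multiset.filterMap_le_filterMap _ h

theorem bsum_allElems {κ : ℕ} {B : Bunch} (h : vol B ≤ κ) : bsum (allElems κ B) = κ := by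
  rw [bsum_eq, actualItems_allElems, slackPart_allElems, sum_slackItems]
  exact Nat.add_sub_cancel' h

theorem allElems_pow {κ : ℕ} {B : Bunch} (hB : ∀ v ∈ B, ∃ k, v = 2 ^ k) :
    ∀ e ∈ allElems κ B, ∃ k, e.size = 2 ^ k := by
  intro e he
  simp only [allElems, Multiset.mem_add, Multiset.mem_map] at he
  rcases he with ⟨v, hv, rfl⟩ | ⟨v, hv, rfl⟩
  exacts [hB v hv, slackItems_pow hv]

/-! ### The loop that forms bundles -/

theorem bsum_join (L : Multiset Bundle) : bsum L.join = (L.map bsum).sum := by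
  induction L using Multiset.induction_on with
  | empty => rfl
  | cons b L ih => simp [bsum_add, ih]

/-- The loop invariant of the formation of bundles with sum `2 ^ p`. -/
structure BundleInv (κ : ℕ) (B : Bunch) (p j : ℕ) (L : Multiset Bundle) : Prop where
  join : L.join = allElems κ B
  le : j ≤ p
  lt_log : p < Nat.log 2 κ
  pow : ∀ b ∈ L, ∃ k, bsum b = 2 ^ k
  small : ∃ b ∈ L, bsum b ≤ 2 ^ p
  one : ∀ k < j, (L.map bsum).count (2 ^ k) ≤ 1

theorem BundleInv.init {κ p : ℕ} {B : Bunch} (hB : ∀ v ∈ B, ∃ k, v = 2 ^ k)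
    (h : BundleInput κ B p) : BundleInv κ B p 0 (initBundles κ B) where
  join := by
    rw [initBundles]
    induction allElems κ B using Multiset.induction_on with
    | empty => rfl
    | cons e s ih => simp [ih]
  le := Nat.zero_le _
  lt_log := h.1
  pow := by
    intro b hb
    obtain ⟨e, he, rfl⟩ := Multiset.mem_map.1 hb
    simpa [bsum] using allElems_pow hB e he
  small := by
    obtain ⟨e, he, hp⟩ := h.2
    exact ⟨{e}, Multiset.mem_map_of_mem _ he, by simpa [bsum] using hp⟩
  one := by simp

theorem BundleInv.merge {κ p j : ℕ} {B : Bunch} {b₁ b₂ : Bundle} {R : Multiset Bundle}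
    (h : BundleInv κ B p j (b₁ ::ₘ b₂ ::ₘ R)) (hj : j < p) (h₁ : bsum b₁ = 2 ^ j)
    (h₂ : bsum b₂ = 2 ^ j) : BundleInv κ B p j ((b₁ + b₂) ::ₘ R) := by
  have h12 : bsum (b₁ + b₂) = 2 ^ (j + 1) := by rw [bsum_add, h₁, h₂]; ring
  refine ⟨?_, h.le, h.lt_log, ?_, ?_, ?_⟩
  · rw [← h.join]; simp [add_assoc]
  · intro b hb
    rcases Multiset.mem_cons.1 hb with rfl | hb
    · exact ⟨_, h12⟩
    · exact h.pow b (by simp [hb])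
  -- The merged bundle is itself small enough, since `j < p`.
  · exact ⟨_, Multiset.mem_cons_self _ _, h12 ▸ Nat.pow_le_pow_right (by norm_num) hj⟩
  · intro k hk
    have := h.one k hk
    have hne : (2 : ℕ) ^ k ≠ 2 ^ (j + 1) := fun h => by
      have := Nat.pow_right_injective le_rfl h; omega
    have hne' : (2 : ℕ) ^ k ≠ 2 ^ j := fun h => by
      have := Nat.pow_right_injective le_rfl h; omega
    rw [Multiset.map_cons, h12, Multiset.count_cons_of_ne hne]
    rwa [Multiset.map_cons, Multiset.map_cons, h₁, h₂, Multiset.count_cons_of_ne hne',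
      Multiset.count_cons_of_ne hne'] at this

theorem exists_two_bundles {L : Multiset Bundle} {m : ℕ} (h : 2 ≤ (L.map bsum).count m) :
    ∃ (b₁ b₂ : Bundle) (R : Multiset Bundle), L = b₁ ::ₘ b₂ ::ₘ R ∧ bsum b₁ = m ∧ bsum b₂ = m := by
  obtain ⟨b₁, h₁, rfl⟩ := Multiset.mem_map.1 (Multiset.count_pos.1 (by omega : 0 < (L.map bsum).count m))
  obtain ⟨R, rfl⟩ := Multiset.exists_cons_of_mem h₁
  rw [Multiset.map_cons, Multiset.count_cons_self] at h
  obtain ⟨b₂, h₂, h2⟩ := Multiset.mem_map.1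
    (Multiset.count_pos.1 (by omega : 0 < (R.map bsum).count (bsum b₁)))
  obtain ⟨R, rfl⟩ := Multiset.exists_cons_of_mem h₂
  exact ⟨b₁, b₂, R, rfl, rfl, h2⟩

theorem BundleInv.next {κ p j : ℕ} {B : Bunch} {L : Multiset Bundle}
    (h : BundleInv κ B p j L) (hj : j < p)
    (hn : ¬ ∃ (b₁ b₂ : Bundle) (R : Multiset Bundle),
      L = b₁ ::ₘ b₂ ::ₘ R ∧ bsum b₁ = 2 ^ j ∧ bsum b₂ = 2 ^ j) : BundleInv κ B p (j + 1) L := by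
  refine ⟨h.join, hj, h.lt_log, h.pow, h.small, fun k hk => ?_⟩
  rcases (Nat.lt_succ_iff.1 hk).lt_or_eq with hk | rfl
  · exact h.one k hk
  · by_contra hc
    exact hn (exists_two_bundles (by omega))

/-- When the loop ends, no sum below `2 ^ p` is repeated, while all sums still add up to `2 ^ a`;
the parity argument applies to the sums. -/
theorem BundleInv.exists_two {a p : ℕ} {B : Bunch} {L : Multiset Bundle}
    (h : BundleInv (2 ^ a) B p p L) (hB : vol B ≤ 2 ^ a) :
    ∃ (b₁ b₂ : Bundle) (R : Multiset Bundle),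
      L = b₁ ::ₘ b₂ ::ₘ R ∧ bsum b₁ = 2 ^ p ∧ bsum b₂ = 2 ^ p := by
  have hpa := h.lt_log
  rw [Nat.log_pow (by norm_num)] at hpa
  refine exists_two_bundles (two_le_count_two_pow _ hpa ?_ ?_ ?_ h.one)
  · rw [← bsum_join, h.join, bsum_allElems hB]
  · intro v hv
    obtain ⟨b, hb, rfl⟩ := Multiset.mem_map.1 hv
    exact h.pow b hb
  · obtain ⟨b, hb, hp⟩ := h.small
    exact ⟨_, Multiset.mem_map_of_mem _ hb, hp⟩

theorem BundleInv.pair_le {κ p j : ℕ} {B : Bunch} {b₁ b₂ : Bundle} {R : Multiset Bundle}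
    (h : BundleInv κ B p j (b₁ ::ₘ b₂ ::ₘ R)) : b₁ + b₂ ≤ allElems κ B := by
  rw [← h.join]
  simp [← add_assoc]

/-- Two disjoint bundles with the same sum do not both consist of slack items. -/
theorem actualItems_ne_zero_of_pair {κ q : ℕ} {B : Bunch} {b₁ b₂ : Bundle}
    (h : b₁ + b₂ ≤ allElems κ B) (h₁ : bsum b₁ = 2 ^ q) (h₂ : bsum b₂ = 2 ^ q)
    (h0 : actualItems b₁ = 0) : actualItems b₂ ≠ 0 := by
  intro h0'
  rw [bsum_eq, h0, Multiset.sum_zero, zero_add] at h₁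
  rw [bsum_eq, h0', Multiset.sum_zero, zero_add] at h₂
  have hle := slackPart_le h
  obtain ⟨R, hR⟩ := Multiset.le_iff_exists_add.1 hle
  rw [slackPart_add] at hR
  have hs := sum_slackItems κ B
  rw [hR] at hs
  -- If both bundles were pure slack, replacing their at least two slack items by the single power
  -- `2 ^ (q + 1)` would represent the slack by fewer powers of two than its binary expansion.
  have hc := card_slackItems_le (κ := κ) (B := B) (2 ^ (q + 1) ::ₘ R) (by
    intro v hv
    rcases Multiset.mem_cons.1 hv with rfl | hv
    · exact ⟨_, rfl⟩
    · exact slackItems_pow (hR ▸ Multiset.mem_add.2 (Or.inr hv))) (by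
    rw [← hs, Multiset.sum_cons, Multiset.sum_add, Multiset.sum_add, h₁, h₂]; ring)
  rw [hR, Multiset.card_add, Multiset.card_add, Multiset.card_cons] at hc
  have e1 : (slackPart b₁).card ≠ 0 := fun h => by
    rw [Multiset.card_eq_zero.1 h] at h₁; exact (Nat.two_pow_pos q).ne h₁
  have e2 : (slackPart b₂).card ≠ 0 := fun h => by
    rw [Multiset.card_eq_zero.1 h] at h₂; exact (Nat.two_pow_pos q).ne h₂
  omega

/-- Moving the actual items of a bundle with sum `2 ^ q` between bunches that both have a slack item
`2 ^ q` decreases the number of slack items. -/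
theorem card_slackItems_lt_of_move {κ q : ℕ} {B D B' D' : Bunch} {b : Bundle}
    (hB : ∀ v ∈ B, ∃ k, v = 2 ^ k) (hb : b ≤ allElems κ B) (hsum : bsum b = 2 ^ q)
    (hne : actualItems b ≠ 0) (hqB : 2 ^ q ∈ slackItems κ B) (hqD : 2 ^ q ∈ slackItems κ D)
    (hB' : slack κ B' = slack κ B + (actualItems b).sum)
    (hD' : slack κ D = slack κ D' + (actualItems b).sum) :
    (slackItems κ B').card + (slackItems κ D').card
      < (slackItems κ B).card + (slackItems κ D).card := by
  rw [bsum_eq] at hsum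
  have hpos : 0 < (actualItems b).sum := by
    obtain ⟨v, hv⟩ := Multiset.exists_mem_of_ne_zero hne
    obtain ⟨k, rfl⟩ := hB v (Multiset.mem_of_le (actualItems_le hb) hv)
    exact lt_of_lt_of_le (by positivity) (Multiset.le_sum_of_mem hv)
  obtain ⟨R, hR⟩ := Multiset.le_iff_exists_add.1 (slackPart_le hb)
  -- An actual item takes up part of the sum `2 ^ q`, so the slack item `2 ^ q` of the donor lies
  -- outside the bundle.
  have hnot : 2 ^ q ∉ slackPart b := fun h => by
    have := Multiset.le_sum_of_mem h; omega
  have hqR : 2 ^ q ∈ R := by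
    rw [hR] at hqB
    exact (Multiset.mem_add.1 hqB).resolve_left hnot
  obtain ⟨R, rfl⟩ := Multiset.exists_cons_of_mem hqR
  obtain ⟨Q, hQ⟩ := Multiset.exists_cons_of_mem hqD
  have hsB := sum_slackItems κ B
  have hsD := sum_slackItems κ D
  rw [hR, Multiset.sum_add, Multiset.sum_cons] at hsB
  rw [hQ, Multiset.sum_cons] at hsD
  -- In the donor, the vacated bundle and the slack item `2 ^ q` combine to `2 ^ (q + 1)`. In the
  -- recipient, the slack part of the bundle replaces `2 ^ q`. Together these representations use
  -- one power fewer than before.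
  have c1 := card_slackItems_le (κ := κ) (B := B') (2 ^ (q + 1) ::ₘ R) (by
    intro v hv
    rcases Multiset.mem_cons.1 hv with rfl | hv
    · exact ⟨_, rfl⟩
    · exact slackItems_pow (hR ▸ Multiset.mem_add.2 (Or.inr (Multiset.mem_cons_of_mem hv)))) (by
    rw [Multiset.sum_cons, pow_succ]; omega)
  have c2 := card_slackItems_le (κ := κ) (B := D') (slackPart b + Q) (by
    intro v hv
    rcases Multiset.mem_add.1 hv with hv | hv
    · exact slackItems_pow (hR ▸ Multiset.mem_add.2 (Or.inl hv))
    · exact slackItems_pow (hQ ▸ Multiset.mem_cons_of_mem hv)) (by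
    rw [Multiset.sum_add]; omega)
  rw [hR, hQ]
  simp only [Multiset.card_add, Multiset.card_cons] at *
  omega

end SettleItems

/-! ### Adjacent configurations and necessity of the slack condition -/

theorem sub_eq_self_of_disjoint {α : Type*} [DecidableEq α] {s t : Multiset α}
    (h : Disjoint s t) : s - t = s := by
  have := Multiset.sub_add_inter s t
  rwa [Multiset.inter_eq_zero_iff_disjoint.2 h, add_zero] at this

/-- Adjacency is stated with multiset differences, so the old and the new pair must be disjoint.
They meet only if the donor without `u` equals the recipient; then the move interchanges the two
bunches and `C = D`. -/
theorem adjacent_of_ne {κ : ℕ} {C D R : Config} {Bd Br : Bunch} {u : ℕ} (hu : u ∈ Bd)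
    (hC : C = {Bd, Br} + R) (hD : D = {Bd.erase u, u ::ₘ Br} + R) (hlC : IsLegal κ C)
    (hlD : IsLegal κ D) (hne : C ≠ D) : Adjacent κ C D := by
  obtain ⟨A, rfl⟩ := Multiset.exists_cons_of_mem hu
  rw [Multiset.erase_cons_head] at hD
  have hdis : ∀ a ∈ ({u ::ₘ A, Br} : Config), ∀ b ∈ ({A, u ::ₘ Br} : Config), a ≠ b := by
    have h1 : ∀ X : Bunch, u ::ₘ X ≠ X := fun X h => by
      have := congrArg Multiset.card h
      simp at this
    have hAB : A ≠ Br := by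
      rintro rfl
      refine hne ?_
      rw [hC, hD, Multiset.pair_comm]
    simp only [Multiset.insert_eq_cons, Multiset.mem_cons, Multiset.mem_singleton]
    rintro a (rfl | rfl) b (rfl | rfl)
    · exact h1 _
    · exact fun h => hAB ((Multiset.cons_inj_right u).1 h)
    · exact hAB.symm
    · exact (h1 _).symm
  have hdis' := Multiset.disjoint_iff_ne.2 hdis
  refine ⟨hlC, hlD, u ::ₘ A, Br, A, u ::ₘ Br, ?_, ?_, u, Multiset.mem_cons_self _ _, ?_, rfl⟩
  · rw [hC, hD, add_tsub_add_eq_tsub_right]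
    exact sub_eq_self_of_disjoint hdis'
  · rw [hC, hD, add_tsub_add_eq_tsub_right]
    exact sub_eq_self_of_disjoint hdis'.symm
  · rw [Multiset.erase_cons_head]

theorem Adjacent.exists_eq {κ : ℕ} {C D : Config} (h : Adjacent κ C D) :
    ∃ (A Br : Bunch) (R : Config) (u : ℕ), C = {u ::ₘ A, Br} + R ∧ D = {A, u ::ₘ Br} + R := by
  obtain ⟨-, -, Bd, Br, Bd₁, Br₁, h1, h2, u, hu, rfl, rfl⟩ := h
  obtain ⟨A, rfl⟩ := Multiset.exists_cons_of_mem hu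
  rw [Multiset.erase_cons_head] at h2
  refine ⟨A, Br, C ∩ D, u, ?_, ?_⟩
  · rw [← h1, Multiset.sub_add_inter]
  · rw [← h2, Multiset.inter_comm, Multiset.sub_add_inter]

theorem Adjacent.totalSlack_eq {κ : ℕ} {C D : Config} (h : Adjacent κ C D) :
    totalSlack κ D = totalSlack κ C := by
  obtain ⟨A, Br, R, u, rfl, rfl⟩ := h.exists_eq
  have h1 := h.1 (u ::ₘ A) (by simp)
  have h2 := h.2.1 (u ::ₘ Br) (by simp)
  simp only [vol, Multiset.sum_cons] at h1 h2
  simp [totalSlack, slack, vol]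
  omega

open Classical in
/-- The large items of the bunches that contain large items. -/
noncomputable def profile (s : ℕ) (C : Config) : Multiset (Multiset ℕ) :=
  (C.filter fun B => ∃ u ∈ B, s ≤ u).map (atLeast s)

/-- A matching of bunches by equal large parts exists exactly if the multisets of large parts
coincide. This form makes settledness a comparison of invariants. -/
theorem settled_iff_profile {s : ℕ} {C D : Config} : Settled s C D ↔ profile s C = profile s D := by
  rw [Settled, profile, profile, ← Multiset.rel_eq, Multiset.rel_map]

theorem atLeast_cons_of_lt {s u : ℕ} (h : u < s) (B : Bunch) : atLeast s (u ::ₘ B) = atLeast s B :=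
  Multiset.filter_cons_of_neg _ (not_le.2 h)

theorem exists_cons_iff_of_lt {s u : ℕ} (h : u < s) (B : Bunch) :
    (∃ v ∈ u ::ₘ B, s ≤ v) ↔ ∃ v ∈ B, s ≤ v := by
  constructor
  · rintro ⟨v, hv, hs⟩
    rcases Multiset.mem_cons.1 hv with rfl | hv
    · omega
    · exact ⟨v, hv, hs⟩
  · rintro ⟨v, hv, hs⟩
    exact ⟨v, Multiset.mem_cons_of_mem hv, hs⟩

theorem profile_add (s : ℕ) (C D : Config) : profile s (C + D) = profile s C + profile s D := by
  simp [profile]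

theorem profile_singleton_cons {s u : ℕ} (h : u < s) (A : Bunch) :
    profile s {u ::ₘ A} = profile s {A} := by
  by_cases hA : ∃ v ∈ A, s ≤ v
  · have hA' := (exists_cons_iff_of_lt h A).2 hA
    rw [profile, profile, Multiset.filter_singleton, Multiset.filter_singleton, if_pos hA,
      if_pos hA', Multiset.map_singleton, Multiset.map_singleton, atLeast_cons_of_lt h]
  · have hA' := mt (exists_cons_iff_of_lt h A).1 hA
    rw [profile, profile, Multiset.filter_singleton, Multiset.filter_singleton, if_neg hA,
      if_neg hA']

theorem profile_cons_cons_congr {s u : ℕ} (h : u < s) (A B : Bunch) :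
    profile s {u ::ₘ A, B} = profile s {A, u ::ₘ B} := by
  have hpair : ∀ X Y : Bunch, ({X, Y} : Config) = {X} + {Y} := fun X Y => rfl
  rw [hpair, hpair, profile_add, profile_add, profile_singleton_cons h, profile_singleton_cons h]

/-- The moved item is at most the slack of its recipient, hence at most the total slack and below
`s`; items below `s` do not enter the profile. -/
theorem Adjacent.profile_eq {κ s : ℕ} {C D : Config} (h : Adjacent κ C D)
    (hs : totalSlack κ C < s) : profile s D = profile s C := by
  obtain ⟨A, Br, R, u, rfl, rfl⟩ := h.exists_eq
  have h2 := h.2.1 (u ::ₘ Br) (by simp)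
  simp only [vol, Multiset.sum_cons] at h2
  have hu : u < s := by
    simp [totalSlack, slack, vol] at hs
    omega
  rw [profile_add, profile_add, profile_cons_cons_congr hu]

theorem profile_eq_of_isChain {κ s : ℕ} {C D : Config} (L : List Config)
    (hL : (C :: L).IsChain (Adjacent κ)) (hlast : (C :: L).getLast? = some D)
    (hs : totalSlack κ C < s) : profile s C = profile s D := by
  induction L generalizing C with
  | nil => simp at hlast; rw [hlast]
  | cons E L ih =>
    rw [List.isChain_cons_cons] at hL
    rw [List.getLast?_cons_cons] at hlast
    rw [← hL.1.profile_eq hs]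
    exact ih hL.2 hlast (hL.1.totalSlack_eq ▸ hs)

theorem largestUnsettled_le {C CT : Config} {K : ℕ}
    (h : ∀ v ∈ underlying C, ¬ Settled v C CT → v ≤ K) : largestUnsettled C CT ≤ K := by
  classical
  refine Finset.sup_le fun v hv => ?_
  rw [Finset.mem_filter, Multiset.mem_toFinset] at hv
  exact h v hv.1 hv.2

theorem le_largestUnsettled {C CT : Config} {v : ℕ} (hv : v ∈ underlying C)
    (h : ¬ Settled v C CT) : v ≤ largestUnsettled C CT := by
  classical
  exact Finset.le_sup (f := id)
    (Finset.mem_filter.2 ⟨Multiset.mem_toFinset.2 hv, h⟩)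

/-- The necessity of the slack condition: a size above the total slack keeps its profile along the
whole sequence, so it is settled at the start. -/
theorem Reconfigurable.largestUnsettled_le {κ : ℕ} {CS CT : Config}
    (h : Reconfigurable κ CS CT) : largestUnsettled CS CT ≤ totalSlack κ CS := by
  obtain ⟨L, hhead, hlast, -, hchain⟩ := h
  refine Repacking.largestUnsettled_le fun v _ hns => ?_
  by_contra hlt
  match L, hhead with
  | C :: L, hhead =>
    obtain rfl : C = CS := by simpa using hhead
    exact hns (settled_iff_profile.2 (profile_eq_of_isChain L hchain hlast (not_le.1 hlt)))

/-! ### Removing immediate repetitions -/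

theorem destutter'_spec {α : Type*} [DecidableEq α] {r : α → α → Prop} (a : α) (l : List α)
    (h : (a :: l).IsChain fun x y => x = y ∨ r x y) :
    (l.destutter' (fun x y => x ≠ y) a).head? = some a ∧
    (l.destutter' (fun x y => x ≠ y) a).getLast? = (a :: l).getLast? ∧
    (l.destutter' (fun x y => x ≠ y) a).IsChain r := by
  induction l generalizing a with
  | nil => simp
  | cons b l ih =>
    rw [List.isChain_cons_cons] at h
    by_cases hab : a = b
    · subst hab
      rw [List.destutter'_cons_neg _ (by simp), List.getLast?_cons_cons]
      exact ih a h.2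
    · rw [List.destutter'_cons_pos _ hab]
      obtain ⟨h1, h2, h3⟩ := ih b h.2
      refine ⟨rfl, ?_, ?_⟩
      · cases hd : l.destutter' (fun x y => x ≠ y) b with
        | nil => rw [hd] at h1; simp at h1
        | cons c l' => rw [List.getLast?_cons_cons, List.getLast?_cons_cons, ← hd, h2]
      · rw [List.isChain_cons]
        refine ⟨fun y hy => ?_, h3⟩
        rw [h1] at hy
        obtain rfl : b = y := by simpa using hy
        exact h.1.resolve_left hab

namespace SettleItems

/-! ### Named bunches -/

variable {n : ℕ}

theorem underlying_config (B : Fin n → Bunch) : underlying (config B) = ∑ x, B x := by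
  simp only [underlying, config, Finset.sum, Multiset.join]

theorem totalSlack_config (κ : ℕ) (B : Fin n → Bunch) :
    totalSlack κ (config B) = ∑ x, slack κ (B x) := by
  simp only [totalSlack, config, Multiset.map_map, Finset.sum, Function.comp_def]

theorem mem_config {B : Fin n → Bunch} {D : Bunch} : D ∈ config B ↔ ∃ x, B x = D := by
  simp [config]

theorem exists_config_eq {n : ℕ} (C : Config) (h : C.card = n) :
    ∃ B : Fin n → Bunch, config B = C := by
  subst h
  induction C using Quotient.inductionOn with
  | _ l =>
    refine ⟨fun x => l.get x, ?_⟩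
    simp only [config, Fin.univ_val_map]
    exact congrArg _ (List.ofFn_get l)

theorem config_eq_pair_add (B : Fin n → Bunch) {x y : Fin n} (h : x ≠ y) :
    config B = {B x, B y} + ((Finset.univ.erase x).erase y).val.map B := by
  have hx : (Finset.univ : Finset (Fin n)) = insert x (insert y ((Finset.univ.erase x).erase y)) := by
    rw [Finset.insert_erase (by simp [h.symm]), Finset.insert_erase (by simp)]
  rw [config]
  conv_lhs => rw [hx]
  rw [Finset.insert_val_of_notMem (by simp [h]), Finset.insert_val_of_notMem (by simp)]
  simp

/-- The bunches after the multiset `M` has moved from `x` to `y` and `N` from `y` to `x`. -/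
def exchange (B : Fin n → Bunch) (x y : Fin n) (M N : Multiset ℕ) : Fin n → Bunch :=
  Function.update (Function.update B x (B x - M + N)) y (B y - N + M)

theorem exchange_left (B : Fin n → Bunch) {x y : Fin n} (h : x ≠ y) (M N : Multiset ℕ) :
    exchange B x y M N x = B x - M + N := by simp [exchange, h]

theorem exchange_right (B : Fin n → Bunch) (x y : Fin n) (M N : Multiset ℕ) :
    exchange B x y M N y = B y - N + M := by simp [exchange]

theorem exchange_of_ne (B : Fin n → Bunch) {x y z : Fin n} (hx : z ≠ x) (hy : z ≠ y)
    (M N : Multiset ℕ) : exchange B x y M N z = B z := by simp [exchange, hx, hy]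

theorem exchange_comm (B : Fin n → Bunch) {x y : Fin n} (h : x ≠ y) (M N : Multiset ℕ) :
    exchange B x y M N = exchange B y x N M := by
  rw [exchange, exchange, Function.update_comm h]

theorem moveItem_eq_exchange (B : Fin n → Bunch) (u : ℕ) (x y : Fin n) :
    moveItem B u x y = exchange B x y {u} 0 := by
  simp [moveItem, exchange, Multiset.sub_singleton, add_comm _ {u}]

theorem sum_split {M : Type*} [AddCommMonoid M] (f : Fin n → M) {x y : Fin n} (h : x ≠ y) :
    ∑ z, f z = f x + f y + ∑ z ∈ (Finset.univ.erase x).erase y, f z := by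
  rw [add_assoc, Finset.add_sum_erase _ _ (by simp [h.symm]), Finset.add_sum_erase _ _ (by simp)]

theorem sum_exchange (B : Fin n → Bunch) {x y : Fin n} (h : x ≠ y) {M N : Multiset ℕ}
    (hM : M ≤ B x) (hN : N ≤ B y) : ∑ z, exchange B x y M N z = ∑ z, B z := by
  rw [sum_split _ h, sum_split B h, exchange_left _ h, exchange_right]
  congr 1
  · obtain ⟨P, hP⟩ := Multiset.le_iff_exists_add.1 hM
    obtain ⟨Q, hQ⟩ := Multiset.le_iff_exists_add.1 hN
    rw [hP, hQ, add_tsub_cancel_left, add_tsub_cancel_left]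
    abel
  · refine Finset.sum_congr rfl fun z hz => exchange_of_ne _ ?_ ?_ _ _
    · exact Finset.ne_of_mem_erase (Finset.mem_of_mem_erase hz)
    · exact Finset.ne_of_mem_erase hz

/-- A legal family of bunches with the same items as the target `T`. -/
structure Good (κ : ℕ) (T B : Fin n → Bunch) : Prop where
  legal : ∀ x, vol (B x) ≤ κ
  items : ∑ x, B x = ∑ x, T x

theorem Good.isLegal {κ : ℕ} {T B : Fin n → Bunch} (h : Good κ T B) : IsLegal κ (config B) := by
  intro D hD
  obtain ⟨x, rfl⟩ := mem_config.1 hD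
  exact h.legal x

theorem Good.mem {κ : ℕ} {T B : Fin n → Bunch} (h : Good κ T B) {x : Fin n} {v : ℕ}
    (hv : v ∈ B x) : v ∈ ∑ x, T x := by
  rw [← h.items]
  exact Multiset.mem_of_le (Finset.single_le_sum (fun _ _ => Multiset.zero_le _) (Finset.mem_univ x)) hv

/-- The total slack depends only on the number of bunches, the capacity and the items, so it is the
same for all families met by the algorithm. -/
theorem Good.sum_slack {κ : ℕ} {T B : Fin n → Bunch} (h : Good κ T B) :
    ∑ x, slack κ (B x) + (∑ x, T x).sum = n * κ := by
  rw [← h.items]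
  have : (∑ x, B x).sum = ∑ x, vol (B x) := by
    simp only [vol]
    exact map_sum Multiset.sumAddMonoidHom B Finset.univ
  rw [this, ← Finset.sum_add_distrib]
  have : ∀ x ∈ Finset.univ, slack κ (B x) + vol (B x) = κ :=
    fun x _ => Nat.sub_add_cancel (h.legal x)
  rw [Finset.sum_congr rfl this]
  simp

theorem slack_exchange_left {κ : ℕ} (B : Fin n → Bunch) {x y : Fin n} (h : x ≠ y)
    {M N : Multiset ℕ} (hM : M ≤ B x) (hx : vol (B x) ≤ κ) (hN : N.sum ≤ slack κ (B x) + M.sum) :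
    vol (exchange B x y M N x) ≤ κ ∧
      slack κ (exchange B x y M N x) + N.sum = slack κ (B x) + M.sum := by
  rw [exchange_left _ h]
  obtain ⟨P, hP⟩ := Multiset.le_iff_exists_add.1 hM
  rw [hP] at hN hx ⊢
  rw [add_tsub_cancel_left]
  simp only [slack, vol, Multiset.sum_add] at *
  omega

theorem slack_exchange_right {κ : ℕ} (B : Fin n → Bunch) {x y : Fin n} (h : x ≠ y)
    {M N : Multiset ℕ} (hN : N ≤ B y) (hy : vol (B y) ≤ κ) (hM : M.sum ≤ slack κ (B y) + N.sum) :
    vol (exchange B x y M N y) ≤ κ ∧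
      slack κ (exchange B x y M N y) + M.sum = slack κ (B y) + N.sum := by
  rw [exchange_comm _ h]
  exact slack_exchange_left B h.symm hN hy hM

theorem Good.exchange {κ : ℕ} {T B : Fin n → Bunch} (hB : Good κ T B) {x y : Fin n} (h : x ≠ y)
    {M N : Multiset ℕ} (hM : M ≤ B x) (hN : N ≤ B y) (hx : N.sum ≤ slack κ (B x) + M.sum)
    (hy : M.sum ≤ slack κ (B y) + N.sum) : Good κ T (exchange B x y M N) where
  legal z := by
    by_cases hzx : z = x
    · subst hzx
      exact (slack_exchange_left B h hM (hB.legal _) hx).1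
    by_cases hzy : z = y
    · subst hzy
      exact (slack_exchange_right B h hN (hB.legal _) hy).1
    · rw [exchange_of_ne _ hzx hzy]
      exact hB.legal z
  items := (sum_exchange B h hM hN).trans hB.items

/-! ### Sequences of moves -/

def applyMove (B : Fin n → Bunch) (m : Move n) : Fin n → Bunch :=
  if m.src = m.dst then B else moveItem B m.item m.src m.dst

def CanMove (κ : ℕ) (B : Fin n → Bunch) (m : Move n) : Prop :=
  m.item ∈ B m.src ∧ (m.src ≠ m.dst → m.item ≤ slack κ (B m.dst))

/-- The moves in a list can be carried out one after another, and lead from `B` to `B'`. -/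
inductive Runs (κ : ℕ) : (Fin n → Bunch) → List (Move n) → (Fin n → Bunch) → Prop
  | nil (B : Fin n → Bunch) : Runs κ B [] B
  | cons {B B' : Fin n → Bunch} {m : Move n} {ms : List (Move n)} (h : CanMove κ B m)
      (hr : Runs κ (applyMove B m) ms B') : Runs κ B (m :: ms) B'

theorem Runs.append {κ : ℕ} {B B' B'' : Fin n → Bunch} {ms ms' : List (Move n)}
    (h : Runs κ B ms B') (h' : Runs κ B' ms' B'') : Runs κ B (ms ++ ms') B'' := by
  induction h with
  | nil => exact h'
  | cons hc _ ih => exact .cons hc (ih h')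

theorem Good.moveItem {κ : ℕ} {T B : Fin n → Bunch} (hB : Good κ T B) {x y : Fin n} (h : x ≠ y)
    {u : ℕ} (hu : u ∈ B x) (hfit : u ≤ slack κ (B y)) : Good κ T (moveItem B u x y) := by
  rw [moveItem_eq_exchange]
  exact hB.exchange h (by simpa using hu) (Multiset.zero_le _) (by simp) (by simpa using hfit)

theorem Good.runs {κ : ℕ} {T B B' : Fin n → Bunch} {ms : List (Move n)} (hB : Good κ T B)
    (h : Runs κ B ms B') : Good κ T B' := by
  induction h with
  | nil => exact hB
  | cons hc _ ih =>
    refine ih ?_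
    rw [applyMove]
    split_ifs with hxy
    · exact hB
    · exact hB.moveItem hxy hc.1 (hc.2 hxy)

/-- Equality can occur although a named bunch changes: the move may just interchange the contents of
two bunches. Such repetitions are removed later. -/
theorem Good.adjacent_moveItem {κ : ℕ} {T B : Fin n → Bunch} (hB : Good κ T B) {x y : Fin n}
    (h : x ≠ y) {u : ℕ} (hu : u ∈ B x) (hfit : u ≤ slack κ (B y)) :
    config B = config (SettleItems.moveItem B u x y) ∨
      Adjacent κ (config B) (config (SettleItems.moveItem B u x y)) := by
  refine or_iff_not_imp_left.2 fun hne => ?_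
  refine adjacent_of_ne hu (config_eq_pair_add B h) ?_ hB.isLegal (hB.moveItem h hu hfit).isLegal hne
  rw [config_eq_pair_add _ h]
  congr 1
  · simp [SettleItems.moveItem, h]
  · refine Multiset.map_congr rfl fun z hz => ?_
    have hz' : z ≠ y ∧ z ≠ x := by
      simpa using (show z ∈ (Finset.univ.erase x).erase y from hz)
    simp [SettleItems.moveItem, hz'.1, hz'.2]

/-- Moving the items in a list one by one. -/
theorem runs_map {κ : ℕ} (l : List ℕ) {B : Fin n → Bunch} {x y : Fin n} (h : x ≠ y)
    (hl : (l : Multiset ℕ) ≤ B x) (hfit : l.sum ≤ slack κ (B y)) :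
    Runs κ B (l.map fun v => ⟨v, x, y⟩) (exchange B x y l 0) := by
  induction l generalizing B with
  | nil =>
    have : exchange B x y (([] : List ℕ) : Multiset ℕ) 0 = B := by simp [exchange]
    rw [this]
    exact .nil B
  | cons v l ih =>
    have hv : v ∈ B x := Multiset.mem_of_le hl (by simp)
    obtain ⟨A, hA⟩ := Multiset.exists_cons_of_mem hv
    rw [← Multiset.cons_coe, hA, Multiset.cons_le_cons_iff] at hl
    rw [List.sum_cons] at hfit
    refine .cons ⟨hv, fun _ => (by simpa using by omega)⟩ ?_
    have hm : applyMove B ⟨v, x, y⟩ = moveItem B v x y := if_neg h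
    rw [hm]
    have hmx : moveItem B v x y x = A := by simp [moveItem, h, hA]
    have hmy : moveItem B v x y y = v ::ₘ B y := by simp [moveItem]
    have hex : exchange B x y ((v :: l : List ℕ) : Multiset ℕ) 0
        = exchange (moveItem B v x y) x y l 0 := by
      funext z
      by_cases hzx : z = x
      · subst hzx
        rw [exchange_left _ h, exchange_left _ h, hmx, hA, ← Multiset.cons_coe,
          Multiset.sub_cons, Multiset.erase_cons_head]
      by_cases hzy : z = y
      · subst hzy
        rw [exchange_right, exchange_right, hmy, ← Multiset.cons_coe, tsub_zero, tsub_zero,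
          Multiset.cons_add, Multiset.add_cons]
      · rw [exchange_of_ne _ hzx hzy, exchange_of_ne _ hzx hzy]
        simp [moveItem, hzx, hzy]
    rw [hex]
    refine ih (hmx ▸ hl) ?_
    rw [hmy]
    simp only [slack, vol, Multiset.sum_cons] at *
    omega

/-! ### Partial bijections -/

theorem orElse_eq_some_iff {γ δ : Type*} (f g : γ → Option δ)
    (h : ∀ x y y', y ∈ f x → y' ∈ g x → False) (x : γ) (y : δ) :
    (f x <|> g x) = some y ↔ y ∈ f x ∨ y ∈ g x := by
  cases hf : f x with
  | none => simp
  | some z =>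
    have : g x = none := by
      cases hg : g x with
      | none => rfl
      | some w => exact (h x z w hf hg).elim
    simp [this]

theorem exists_pequiv_union {α β : Type*} (φ ψ : α ≃. β)
    (hdom : ∀ x y y', y ∈ φ x → y' ∈ ψ x → False) (hran : ∀ x x' y, y ∈ φ x → y ∈ ψ x' → False) :
    ∃ χ : α ≃. β, ∀ x y, y ∈ χ x ↔ y ∈ φ x ∨ y ∈ ψ x := by
  have hsymm : ∀ y x x', x ∈ φ.symm y → x' ∈ ψ.symm y → False := fun y x x' h h' =>
    hran x x' y ((PEquiv.mem_iff_mem φ).1 h) ((PEquiv.mem_iff_mem ψ).1 h')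
  refine ⟨⟨fun x => φ x <|> ψ x, fun y => φ.symm y <|> ψ.symm y, fun x y => ?_⟩,
    orElse_eq_some_iff φ ψ hdom⟩
  rw [orElse_eq_some_iff φ ψ hdom, orElse_eq_some_iff φ.symm ψ.symm hsymm, PEquiv.mem_iff_mem,
    PEquiv.mem_iff_mem]

/-- With `rel_of_pequiv` as the converse, this translates between a matching of occurrences and a
partial bijection of names; without repetitions, occurrences are names. -/
theorem exists_pequiv_of_rel {α β : Type*} {r : α → β → Prop} {s : Multiset α} {t : Multiset β}
    (h : Multiset.Rel r s t) (hs : s.Nodup) (ht : t.Nodup) :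
    ∃ φ : α ≃. β, (∀ x, (∃ y, y ∈ φ x) ↔ x ∈ s) ∧ (∀ y, (∃ x, y ∈ φ x) ↔ y ∈ t) ∧
      ∀ x y, y ∈ φ x → r x y := by
  classical
  induction h with
  | zero => exact ⟨⊥, by simp, by simp, by simp⟩
  | @cons a b as bs hab _ ih =>
    rw [Multiset.nodup_cons] at hs ht
    obtain ⟨φ, h1, h2, h3⟩ := ih hs.2 ht.2
    obtain ⟨χ, hχ⟩ := exists_pequiv_union φ (PEquiv.single a b)
      (fun x y y' hy hy' => by
        rw [PEquiv.mem_single_iff] at hy'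
        exact hs.1 (hy'.1 ▸ (h1 x).1 ⟨y, hy⟩))
      (fun x x' y hy hy' => by
        rw [PEquiv.mem_single_iff] at hy'
        exact ht.1 (hy'.2 ▸ (h2 y).1 ⟨x, hy⟩))
    refine ⟨χ, fun x => ?_, fun y => ?_, fun x y hxy => ?_⟩
    · simp only [hχ, exists_or, h1, PEquiv.mem_single_iff, Multiset.mem_cons]
      simp [or_comm]
    · simp only [hχ, exists_or, h2, PEquiv.mem_single_iff, Multiset.mem_cons]
      simp [or_comm]
    · rcases (hχ x y).1 hxy with h | h
      · exact h3 x y h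
      · rw [PEquiv.mem_single_iff] at h
        rw [h.1, h.2]
        exact hab

theorem rel_of_pequiv {α β : Type*} {r : α → β → Prop} (φ : α ≃. β) {s : Finset α} {t : Finset β}
    (h1 : ∀ x, (∃ y, y ∈ φ x) ↔ x ∈ s) (h2 : ∀ y, (∃ x, y ∈ φ x) ↔ y ∈ t)
    (h3 : ∀ x y, y ∈ φ x → r x y) : Multiset.Rel r s.val t.val := by
  classical
  rcases s.eq_empty_or_nonempty with rfl | ⟨x₀, hx₀⟩
  · have : t = ∅ := by
      refine Finset.eq_empty_of_forall_notMem fun y hy => ?_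
      obtain ⟨x, hx⟩ := (h2 y).2 hy
      simpa using (h1 x).1 ⟨y, hx⟩
    subst this
    exact .zero
  · obtain ⟨y₀, -⟩ := (h1 x₀).2 hx₀
    have hf : ∀ x ∈ s, (φ x).getD y₀ ∈ φ x := by
      intro x hx
      obtain ⟨y, hy⟩ := (h1 x).2 hx
      rw [Option.mem_def.1 hy]
      rfl
    have hinj : Set.InjOn (fun x => (φ x).getD y₀) s := by
      intro x hx x' hx' he
      exact φ.inj (hf x hx) ((show (φ x).getD y₀ = (φ x').getD y₀ from he) ▸ hf x' hx')
    have himg : t = s.image fun x => (φ x).getD y₀ := by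
      ext y
      rw [← h2 y, Finset.mem_image]
      constructor
      · rintro ⟨x, hx⟩
        have hxs := (h1 x).1 ⟨y, hx⟩
        exact ⟨x, hxs, Option.mem_unique (hf x hxs) hx⟩
      · rintro ⟨x, hx, rfl⟩
        exact ⟨x, hf x hx⟩
    rw [himg, Finset.image_val_of_injOn hinj, Multiset.rel_map_right]
    exact Multiset.rel_refl_of_refl_on fun x hx => h3 x _ (hf x hx)

open Classical in
theorem settled_config_iff {s : ℕ} {B T : Fin n → Bunch} :
    Settled s (config B) (config T) ↔ ∃ φ, IsSettling s B T φ := by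
  rw [Settled, config, config, Multiset.filter_map, Multiset.filter_map, Multiset.rel_map]
  constructor
  · intro h
    obtain ⟨φ, h1, h2, h3⟩ := exists_pequiv_of_rel h
      (Multiset.Nodup.filter _ Finset.univ.nodup) (Multiset.Nodup.filter _ Finset.univ.nodup)
    exact ⟨φ, by simpa using h1, by simpa using h2, h3⟩
  · rintro ⟨φ, h1, h2, h3⟩
    rw [← Finset.filter_val, ← Finset.filter_val]
    exact rel_of_pequiv φ (by simpa using h1) (by simpa using h2) h3

theorem mem_atLeast {s v : ℕ} {B : Bunch} : v ∈ atLeast s B ↔ v ∈ B ∧ s ≤ v := by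
  simp [atLeast]

theorem filter_lt_eq {u : ℕ} {B D : Bunch} (h : atLeast u B = atLeast u D) :
    B.filter (u < ·) = D.filter (u < ·) := by
  have : ∀ A : Bunch, A.filter (u < ·) = (atLeast u A).filter (u < ·) := fun A => by
    rw [atLeast, Multiset.filter_filter]
    exact Multiset.filter_congr fun x _ => ⟨fun h => ⟨h, h.le⟩, fun h => h.1⟩
  rw [this, this D, h]

theorem atLeast_eq_of_le {s v : ℕ} (hsv : s ≤ v) {B D : Bunch} (h : atLeast s B = atLeast s D) :
    atLeast v B = atLeast v D := by
  have : ∀ A : Bunch, atLeast v A = atLeast v (atLeast s A) := fun A => by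
    rw [atLeast, atLeast, atLeast, Multiset.filter_filter]
    exact Multiset.filter_congr fun x _ => ⟨fun h => ⟨h, hsv.trans h⟩, fun h => h.1⟩
  rw [this, this D, h]

/-! ### The mapping of a stage -/

/-- The mapping `φ` is correct for the items larger than `u`, and covers all items of size at least
`u`. -/
structure MapInv (u : ℕ) (T B : Fin n → Bunch) (φ : Fin n ≃. Fin n) : Prop where
  gt : ∀ x y, y ∈ φ x → (B x).filter (u < ·) = (T y).filter (u < ·)
  left : ∀ x, (∃ v ∈ B x, u ≤ v) → ∃ y, y ∈ φ x
  right : ∀ y, (∃ v ∈ T y, u ≤ v) → ∃ x, y ∈ φ x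

theorem atLeast_eq_filter_add (u : ℕ) (B : Bunch) :
    atLeast u B = B.filter (u < ·) + Multiset.replicate (B.count u) u := by
  ext v
  rw [atLeast, Multiset.count_add, Multiset.count_filter, Multiset.count_filter,
    Multiset.count_replicate]
  rcases lt_trichotomy u v with h | rfl | h
  · simp [h, h.le, h.ne]
  · simp
  · simp [h.not_ge, h.not_gt, h.ne']

theorem MapInv.settled {u : ℕ} {T B : Fin n → Bunch} {φ : Fin n ≃. Fin n} (h : MapInv u T B φ)
    (hc : ∀ x y, y ∈ φ x → (B x).count u = (T y).count u) : Settled u (config B) (config T) := by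
  classical
  have heq : ∀ x y, y ∈ φ x → atLeast u (B x) = atLeast u (T y) := fun x y hxy => by
    rw [atLeast_eq_filter_add, atLeast_eq_filter_add, h.gt x y hxy, hc x y hxy]
  have hiff : ∀ x y, y ∈ φ x → ((∃ v ∈ B x, u ≤ v) ↔ ∃ v ∈ T y, u ≤ v) := fun x y hxy => by
    simp only [← mem_atLeast, heq x y hxy]
  rw [settled_config_iff]
  -- `φ` may also be defined on bunches without items of size at least `u`, so it is restricted
  -- before it can serve as a settling bijection.
  have hmem : ∀ x y, y ∈ (PEquiv.ofSet {x | ∃ v ∈ B x, u ≤ v}).trans φ x ↔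
      (∃ v ∈ B x, u ≤ v) ∧ y ∈ φ x := by
    intro x y
    simp only [PEquiv.mem_trans, PEquiv.mem_ofSet_iff, Set.mem_ofPred_eq]
    constructor
    · rintro ⟨z, ⟨rfl, hz⟩, hy⟩
      exact ⟨hz, hy⟩
    · exact fun hx => ⟨x, ⟨rfl, hx.1⟩, hx.2⟩
  refine ⟨_, fun x => ?_, fun y => ?_, fun x y hxy => heq x y ((hmem x y).1 hxy).2⟩
  · simp only [hmem]
    exact ⟨fun ⟨_, hx, _⟩ => hx, fun hx => (h.left x hx).imp fun _ hy => ⟨hx, hy⟩⟩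
  · simp only [hmem]
    exact ⟨fun ⟨x, hx, hy⟩ => (hiff x y hy).1 hx,
      fun hy => (h.right y hy).imp fun x hx => ⟨(hiff x y hx).2 hy, hx⟩⟩

/-- A settling bijection for `s` satisfies `MapInv` for every larger `v`, with equal multiplicities
of `v`. So a stage that settles `u` leaves only sizes below `u` unsettled. -/
theorem settled_mono {s v : ℕ} (hsv : s ≤ v) {B T : Fin n → Bunch}
    (h : Settled s (config B) (config T)) : Settled v (config B) (config T) := by
  obtain ⟨φ, h1, h2, h3⟩ := settled_config_iff.1 h
  have heq : ∀ x y, y ∈ φ x → atLeast v (B x) = atLeast v (T y) :=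
    fun x y hxy => atLeast_eq_of_le hsv (h3 x y hxy)
  refine MapInv.settled (φ := φ) ⟨fun x y hxy => filter_lt_eq (heq x y hxy), ?_, ?_⟩ ?_
  · rintro x ⟨w, hw, hvw⟩
    exact (h1 x).2 ⟨w, hw, hsv.trans hvw⟩
  · rintro y ⟨w, hw, hvw⟩
    exact (h2 y).2 ⟨w, hw, hsv.trans hvw⟩
  · intro x y hxy
    have := congrArg (Multiset.count v) (heq x y hxy)
    rwa [atLeast, atLeast, Multiset.count_filter_of_pos le_rfl,
      Multiset.count_filter_of_pos le_rfl] at this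

/-! ### Item sizes -/

theorem mem_sizes {T : Fin n → Bunch} {v : ℕ} : v ∈ sizes (config T) ↔ v ∈ ∑ x, T x := by
  rw [sizes, Finset.mem_sort, Multiset.mem_toFinset, underlying_config]

theorem itemSize_eq {T : Fin n → Bunch} {i : ℕ} (hi : i < numStages T) :
    itemSize T i = (sizes (config T))[i]'hi := List.getD_eq_getElem _ _ hi

theorem itemSize_mem {T : Fin n → Bunch} {i : ℕ} (hi : i < numStages T) :
    itemSize T i ∈ ∑ x, T x := by
  rw [← mem_sizes, itemSize_eq hi]
  exact List.getElem_mem hi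

theorem exists_itemSize_eq {T : Fin n → Bunch} {v : ℕ} (hv : v ∈ ∑ x, T x) :
    ∃ i < numStages T, itemSize T i = v := by
  obtain ⟨i, hi, h⟩ := List.getElem_of_mem (mem_sizes.2 hv)
  exact ⟨i, hi, (itemSize_eq hi).trans h⟩

theorem itemSize_lt {T : Fin n → Bunch} {i j : ℕ} (hij : i < j) (hj : j < numStages T) :
    itemSize T j < itemSize T i := by
  rw [itemSize_eq hj, itemSize_eq (hij.trans hj)]
  refine lt_of_le_of_ne ?_ fun h => ?_
  · exact List.pairwise_iff_getElem.1
      (Finset.pairwise_sort (underlying (config T)).toFinset fun a b => b ≤ a) i j _ _ hij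
  · exact hij.ne' ((List.Nodup.getElem_inj_iff (Finset.sort_nodup _ _)).1 h)

theorem le_itemSize_zero {T : Fin n → Bunch} {v : ℕ} (hv : v ∈ ∑ x, T x) : v ≤ itemSize T 0 := by
  obtain ⟨j, hj, rfl⟩ := exists_itemSize_eq hv
  rcases j.eq_zero_or_pos with rfl | h
  · rfl
  · exact (itemSize_lt h hj).le

theorem itemSize_le_of_lt {T : Fin n → Bunch} {i v : ℕ} (hi : i + 1 < numStages T)
    (hv : v ∈ ∑ x, T x) (h : itemSize T (i + 1) < v) : itemSize T i ≤ v := by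
  obtain ⟨j, hj, rfl⟩ := exists_itemSize_eq hv
  rcases lt_trichotomy j i with hji | rfl | hji
  · exact (itemSize_lt hji (by omega)).le
  · rfl
  · rcases (Nat.succ_le_of_lt hji).eq_or_lt with rfl | hji
    · exact absurd h (lt_irrefl _)
    · exact absurd (itemSize_lt hji hj) h.not_gt

theorem itemSize_last_le {T : Fin n → Bunch} {i v : ℕ} (hi : i + 1 = numStages T)
    (hv : v ∈ ∑ x, T x) : itemSize T i ≤ v := by
  obtain ⟨j, hj, rfl⟩ := exists_itemSize_eq hv
  rcases (show j ≤ i by omega).eq_or_lt with rfl | h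
  · rfl
  · exact (itemSize_lt h (by omega)).le

/-! ### Existence and correctness of the mapping -/

/-- The condition under which a stage has an initial mapping. -/
def PrevSettled (B T : Fin n → Bunch) (i : ℕ) : Prop :=
  ∀ k, i = k + 1 → Settled (itemSize T k) (config B) (config T)

/-- An initial mapping is a correct mapping for the items larger than the current size. -/
theorem IsInitialMap.spec {B T : Fin n → Bunch} {i : ℕ} {φ : Fin n ≃. Fin n}
    (hi : i < numStages T) (hBT : ∑ x, B x = ∑ x, T x) (h : IsInitialMap B T i φ) :
    (∀ x, (∃ y, y ∈ φ x) ↔ ∃ v ∈ B x, itemSize T i < v) ∧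
    (∀ y, (∃ x, y ∈ φ x) ↔ ∃ v ∈ T y, itemSize T i < v) ∧
    ∀ x y, y ∈ φ x → (B x).filter (itemSize T i < ·) = (T y).filter (itemSize T i < ·) := by
  have hle : ∀ (A : Fin n → Bunch) x v, v ∈ A x → v ∈ ∑ x, A x := fun A x v hv =>
    Multiset.mem_of_le (Finset.single_le_sum (fun _ _ => Multiset.zero_le _) (Finset.mem_univ x)) hv
  have hmemB : ∀ x v, v ∈ B x → v ∈ ∑ x, T x := fun x v hv => hBT ▸ hle B x v hv
  cases i with
  | zero =>
    have h : φ = ⊥ := h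
    subst h
    refine ⟨fun x => ?_, fun y => ?_, by simp⟩
    · simpa using fun v hv => le_itemSize_zero (hmemB x v hv)
    · simpa using fun v hv => le_itemSize_zero (hle T y v hv)
  | succ i =>
    obtain ⟨h1, h2, h3⟩ := h
    have hlt := itemSize_lt (Nat.lt_succ_self i) hi
    -- No size lies strictly between consecutive item sizes, so being at least the previous size
    -- means exceeding the current one.
    have hiff : ∀ v ∈ ∑ x, T x, (itemSize T i ≤ v ↔ itemSize T (i + 1) < v) := fun v hv =>
      ⟨fun h => hlt.trans_le h, fun h => itemSize_le_of_lt hi hv h⟩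
    refine ⟨fun x => (h1 x).trans ?_, fun y => (h2 y).trans ?_, fun x y hxy => ?_⟩
    · exact exists_congr fun v => and_congr_right fun hv => hiff v (hmemB x v hv)
    · exact exists_congr fun v => and_congr_right fun hv => hiff v (hle T y v hv)
    · rw [← Multiset.filter_congr fun v hv => hiff v (hmemB x v hv),
        ← Multiset.filter_congr fun v hv => hiff v (hle T y v hv)]
      exact h3 x y hxy

theorem mem_withLargest {u : ℕ} {B : Fin n → Bunch} {x : Fin n} :
    x ∈ withLargest u B ↔ HasLargest u (B x) := by
  simp [withLargest]

theorem IsPadding.le {u m : ℕ} {B : Fin n → Bunch} {X : Finset (Fin n)} (h : IsPadding u B m X)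
    {x : Fin n} (hx : x ∈ X) : ∀ v ∈ B x, v ≤ u := by
  by_cases hx' : x ∈ withLargest u B
  · exact (mem_withLargest.1 hx').2
  · exact fun v hv => (h.2.1 x hx hx' v hv).le

theorem hasLargest_of_le {u : ℕ} {B : Bunch} (h : ∃ v ∈ B, u ≤ v) (h' : ∀ v ∈ B, v ≤ u) :
    HasLargest u B := by
  obtain ⟨v, hv, huv⟩ := h
  exact ⟨le_antisymm (h' v hv) huv ▸ hv, h'⟩

theorem IsStageMap.mapInv {B T : Fin n → Bunch} {i : ℕ} {φ : Fin n ≃. Fin n}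
    (hi : i < numStages T) (hBT : ∑ x, B x = ∑ x, T x) (h : IsStageMap B T i φ) :
    MapInv (itemSize T i) T B φ := by
  obtain ⟨φ₀, ψ, X, Y, h0, hX, hY, hψX, hψY, hφ⟩ := h
  obtain ⟨h1, h2, h3⟩ := h0.spec hi hBT
  refine ⟨fun x y hxy => ?_, fun x hx => ?_, fun y hy => ?_⟩
  · rcases (hφ x y).1 hxy with h | h
    · exact h3 x y h
    · rw [Multiset.filter_eq_nil.2 fun v hv => (hX.le ((hψX x).1 ⟨y, h⟩) v hv).not_gt,
        Multiset.filter_eq_nil.2 fun v hv => (hY.le ((hψY y).1 ⟨x, h⟩) v hv).not_gt]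
  · by_cases hx' : ∃ v ∈ B x, itemSize T i < v
    · obtain ⟨y, hy⟩ := (h1 x).2 hx'
      exact ⟨y, (hφ x y).2 (Or.inl hy)⟩
    · push Not at hx'
      obtain ⟨y, hy⟩ := (hψX x).2 (hX.1 (mem_withLargest.2 (hasLargest_of_le hx hx')))
      exact ⟨y, (hφ x y).2 (Or.inr hy)⟩
  · by_cases hy' : ∃ v ∈ T y, itemSize T i < v
    · obtain ⟨x, hx⟩ := (h2 y).2 hy'
      exact ⟨x, (hφ x y).2 (Or.inl hx)⟩
    · push Not at hy'
      obtain ⟨x, hx⟩ := (hψY y).2 (hY.1 (mem_withLargest.2 (hasLargest_of_le hy hy')))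
      exact ⟨x, (hφ x y).2 (Or.inr hx)⟩

open Classical in
theorem exists_isPadding {u m : ℕ} (B : Fin n → Bunch) (h1 : (withLargest u B).card ≤ m)
    (h2 : m ≤ (Finset.univ.filter fun x => ¬ ∃ v ∈ B x, u < v).card) :
    ∃ X, IsPadding u B m X := by
  obtain ⟨X, hX1, hX2, hX3⟩ := Finset.exists_subsuperset_card_eq
    (s := withLargest u B) (t := Finset.univ.filter fun x => ¬ ∃ v ∈ B x, u < v) (fun x hx => by
      simpa using (mem_withLargest.1 hx).2) h1 h2
  refine ⟨X, hX1, fun x hx hx' v hv => ?_, hX3⟩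
  have hle : ∀ v ∈ B x, v ≤ u := by simpa using hX2 hx
  refine lt_of_le_of_ne (hle v hv) ?_
  rintro rfl
  exact hx' (mem_withLargest.2 ⟨hv, hle⟩)

theorem card_withLargest_le (u : ℕ) (B : Fin n → Bunch) [DecidablePred fun x => ¬ ∃ v ∈ B x, u < v] :
    (withLargest u B).card ≤ (Finset.univ.filter fun x => ¬ ∃ v ∈ B x, u < v).card := by
  refine Finset.card_le_card fun x hx => ?_
  simpa using (mem_withLargest.1 hx).2

/-- Padding never runs out of bunches: the initial map pairs the bunches with an item above `u`, so
equally many bunches without such an item remain on both sides. Each of these either has largest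
item `u` or may be used as padding. -/
theorem exists_isStageMap {B T : Fin n → Bunch} {i : ℕ} (hi : i < numStages T)
    (hBT : ∑ x, B x = ∑ x, T x) (h : PrevSettled B T i) : ∃ φ, IsStageMap B T i φ := by
  classical
  have h0 : ∃ φ₀, IsInitialMap B T i φ₀ := by
    cases i with
    | zero => exact ⟨⊥, rfl⟩
    | succ i => exact settled_config_iff.1 (h i rfl)
  obtain ⟨φ₀, hφ₀⟩ := h0
  obtain ⟨h1, h2, h3⟩ := hφ₀.spec hi hBT
  set u := itemSize T i with hu
  have hcard : (Finset.univ.filter fun x => ∃ v ∈ B x, u < v).card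
      = (Finset.univ.filter fun x => ∃ v ∈ T x, u < v).card :=
    Multiset.card_eq_card_of_rel (rel_of_pequiv (r := fun _ _ => True) φ₀
      (by simpa using h1) (by simpa using h2) fun _ _ _ => trivial)
  have hcard' : (Finset.univ.filter fun x => ¬ ∃ v ∈ B x, u < v).card
      = (Finset.univ.filter fun x => ¬ ∃ v ∈ T x, u < v).card := by
    have e1 := Finset.card_filter_add_card_filter_not (s := Finset.univ)
      (fun x => ∃ v ∈ B x, u < v)
    have e2 := Finset.card_filter_add_card_filter_not (s := Finset.univ)
      (fun x => ∃ v ∈ T x, u < v)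
    omega
  have hmax : max (withLargest u B).card (withLargest u T).card
      ≤ (Finset.univ.filter fun x => ¬ ∃ v ∈ B x, u < v).card :=
    max_le (card_withLargest_le u B) (hcard' ▸ card_withLargest_le u T)
  obtain ⟨X, hX⟩ := exists_isPadding B (le_max_left _ _) hmax
  obtain ⟨Y, hY⟩ := exists_isPadding T (le_max_right _ _) (hcard' ▸ hmax)
  obtain ⟨ψ, hψX, hψY, -⟩ := exists_pequiv_of_rel (r := fun _ _ => True) (s := X.val) (t := Y.val)
    (Multiset.rel_of_forall (fun _ _ _ _ => trivial) (hX.2.2.trans hY.2.2.symm)) X.nodup Y.nodup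
  obtain ⟨φ, hφ⟩ := exists_pequiv_union φ₀ ψ
    (fun x y y' hy hy' => by
      obtain ⟨v, hv, huv⟩ := (h1 x).1 ⟨y, hy⟩
      exact (hX.le ((hψX x).1 ⟨y', hy'⟩) v hv).not_gt huv)
    (fun x x' y hy hy' => by
      obtain ⟨v, hv, huv⟩ := (h2 y).1 ⟨x, hy⟩
      exact (hY.le ((hψY y).1 ⟨x', hy'⟩) v hv).not_gt huv)
  exact ⟨φ, φ₀, ψ, X, Y, hφ₀, hX, hY, hψX, hψY, hφ⟩

/-- When the smallest size is settled, the target has been reached. -/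
theorem config_eq_of_prevSettled {B T : Fin n → Bunch} (hBT : ∑ x, B x = ∑ x, T x)
    (h : PrevSettled B T (numStages T)) : config B = config T := by
  classical
  have hle : ∀ (A : Fin n → Bunch), ∑ x, A x = ∑ x, T x → ∀ x, ∀ v ∈ A x, v ∈ ∑ x, T x :=
    fun A hA x v hv => hA ▸ Multiset.mem_of_le
      (Finset.single_le_sum (fun _ _ => Multiset.zero_le _) (Finset.mem_univ x)) hv
  have key : ∃ s, Settled s (config B) (config T) ∧ ∀ v ∈ ∑ x, T x, s ≤ v := by
    cases hN : numStages T with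
    | zero =>
      have hno : ∀ v, v ∉ ∑ x, T x := fun v hv => by
        obtain ⟨i, hi, -⟩ := exists_itemSize_eq hv
        omega
      -- Without any items, the empty map settles size 0.
      refine ⟨0, settled_config_iff.2 ⟨⊥, fun x => ?_, fun y => ?_, by simp⟩,
        fun v hv => (hno v hv).elim⟩
      · simpa using fun v hv => hno v (hle B hBT x v hv)
      · simpa using fun v hv => hno v (hle T rfl y v hv)
    | succ k => exact ⟨itemSize T k, h k hN, fun v hv => itemSize_last_le hN.symm hv⟩
  obtain ⟨s, hs, hmin⟩ := key
  have hprof := settled_iff_profile.1 hs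
  have hp : ∀ A : Fin n → Bunch, ∑ x, A x = ∑ x, T x →
      profile s (config A) = (config A).filter (· ≠ 0) := by
    intro A hA
    have hmem : ∀ D ∈ config A, ∀ v ∈ D, s ≤ v := fun D hD v hv => by
      obtain ⟨x, rfl⟩ := mem_config.1 hD
      exact hmin v (hle A hA x v hv)
    rw [profile, Multiset.filter_congr (q := (· ≠ 0)) fun D hD => ?_]
    · conv_rhs => rw [← Multiset.map_id ((config A).filter _)]
      refine Multiset.map_congr rfl fun D hD => ?_
      exact Multiset.filter_eq_self.2 (hmem D (Multiset.mem_of_mem_filter hD))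
    · constructor
      · rintro ⟨v, hv, -⟩ rfl
        simp at hv
      · intro hne
        obtain ⟨v, hv⟩ := Multiset.exists_mem_of_ne_zero hne
        exact ⟨v, hv, hmem D hD v hv⟩
  rw [hp B hBT, hp T rfl] at hprof
  -- Profiles do not see empty bunches, but both families have `n` bunches, so their numbers of
  -- empty ones agree as well.
  have hz : ∀ A : Fin n → Bunch, (config A).filter (fun D => ¬ D ≠ 0)
      = Multiset.replicate (n - ((config A).filter (· ≠ 0)).card) 0 := by
    intro A
    have hc := congrArg Multiset.card (Multiset.filter_add_not (· ≠ 0) (config A))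
    rw [Multiset.card_add] at hc
    have hn : (config A).card = n := by simp [config]
    rw [hn] at hc
    refine Multiset.eq_replicate.2 ⟨by omega, fun D hD => ?_⟩
    simpa using Multiset.of_mem_filter hD
  rw [← Multiset.filter_add_not (· ≠ 0) (config B), ← Multiset.filter_add_not (· ≠ 0) (config T),
    hz, hz, hprof]

/-! ### Surplus and deficit -/

def Surplus (u : ℕ) (T B : Fin n → Bunch) (φ : Fin n ≃. Fin n) (x : Fin n) : Prop :=
  ∃ y ∈ φ x, (T y).count u < (B x).count u

def Deficit (u : ℕ) (T B : Fin n → Bunch) (φ : Fin n ≃. Fin n) (x : Fin n) : Prop :=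
  ∃ y ∈ φ x, (B x).count u < (T y).count u

/-- The total number of items of size `u` that are missing from the bunches. -/
def totalDeficit (u : ℕ) (T B : Fin n → Bunch) (φ : Fin n ≃. Fin n) : ℕ :=
  ∑ x, (φ x).elim 0 fun y => (T y).count u - (B x).count u

theorem Surplus.ne {u : ℕ} {T B : Fin n → Bunch} {φ : Fin n ≃. Fin n} {s d : Fin n}
    (hs : Surplus u T B φ s) (hd : Deficit u T B φ d) : s ≠ d := by
  rintro rfl
  obtain ⟨y, hy, h⟩ := hs
  obtain ⟨y', hy', h'⟩ := hd
  obtain rfl := Option.mem_unique hy hy'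
  omega

theorem Surplus.mem {u : ℕ} {T B : Fin n → Bunch} {φ : Fin n ≃. Fin n} {s : Fin n}
    (hs : Surplus u T B φ s) : u ∈ B s := by
  obtain ⟨y, -, h⟩ := hs
  exact Multiset.count_pos.1 (by omega)

theorem sum_elim_eq (φ : Fin n ≃. Fin n) (h : Fin n → ℕ) (hφ : ∀ y, h y ≠ 0 → ∃ x, y ∈ φ x) :
    ∑ x, (φ x).elim 0 h = ∑ y, h y := by
  have h1 : ∀ x, (φ x).elim 0 h = ∑ y, if y ∈ φ x then h y else 0 := by
    intro x
    cases hx : φ x with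
    | none => simp
    | some z => simp
  rw [Finset.sum_congr rfl fun x _ => h1 x, Finset.sum_comm]
  refine Finset.sum_congr rfl fun y _ => ?_
  by_cases hy : h y = 0
  · simp [hy]
  · obtain ⟨x, hx⟩ := hφ y hy
    rw [Finset.sum_eq_single x]
    · rw [if_pos hx]
    · intro x' _ hne
      exact if_neg fun hx' => hne (φ.inj hx' hx)
    · simp

/-- Bunches and target have equally many items of size `u`, and all of them lie in the domain and
the range of `φ`. A mismatch in one direction must be balanced by one in the other. -/
theorem MapInv.exists_surplus_deficit {u : ℕ} {T B : Fin n → Bunch} {φ : Fin n ≃. Fin n}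
    (h : MapInv u T B φ) (hBT : ∑ x, B x = ∑ x, T x)
    (hne : ¬ ∀ x y, y ∈ φ x → (B x).count u = (T y).count u) :
    (∃ s, Surplus u T B φ s) ∧ ∃ d, Deficit u T B φ d := by
  have hsum : ∑ x, (B x).count u = ∑ x, (φ x).elim 0 fun y => (T y).count u := by
    rw [sum_elim_eq φ fun y => (T y).count u]
    · rw [← Multiset.count_sum', hBT, Multiset.count_sum']
    · exact fun y hy => h.right y ⟨u, Multiset.count_ne_zero.1 hy, le_rfl⟩
  push Not at hne
  obtain ⟨x₀, y₀, h₀, hne₀⟩ := hne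
  have hx₀ : (φ x₀).elim 0 (fun y => (T y).count u) = (T y₀).count u := by
    rw [Option.mem_def.1 h₀]; rfl
  constructor
  · by_contra hno
    have hle : ∀ x ∈ Finset.univ, (B x).count u ≤ (φ x).elim 0 fun y => (T y).count u := by
      intro x _
      cases hx : φ x with
      | none =>
        refine (Multiset.count_eq_zero.2 fun hu => ?_).le
        obtain ⟨y, hy⟩ := h.left x ⟨u, hu, le_rfl⟩
        rw [hx] at hy
        exact absurd hy (Option.not_mem_none y)
      | some y => exact not_lt.1 fun hlt => hno ⟨x, y, hx, hlt⟩
    refine (Finset.sum_lt_sum hle ⟨x₀, Finset.mem_univ _, ?_⟩).ne hsum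
    exact lt_of_le_of_ne (hle x₀ (Finset.mem_univ _)) (hx₀ ▸ hne₀)
  · by_contra hno
    have hle : ∀ x ∈ Finset.univ, ((φ x).elim 0 fun y => (T y).count u) ≤ (B x).count u := by
      intro x _
      cases hx : φ x with
      | none => exact Nat.zero_le _
      | some y => exact not_lt.1 fun hlt => hno ⟨x, y, hx, hlt⟩
    refine (Finset.sum_lt_sum hle ⟨x₀, Finset.mem_univ _, ?_⟩).ne' hsum
    exact lt_of_le_of_ne (hle x₀ (Finset.mem_univ _)) (hx₀ ▸ hne₀.symm)

/-! ### Changes that do not affect the large items -/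

theorem count_eq_of_atLeast_eq {u : ℕ} {B D : Bunch} (h : atLeast u B = atLeast u D) :
    B.count u = D.count u := by
  have := congrArg (Multiset.count u) h
  rwa [atLeast, atLeast, Multiset.count_filter_of_pos le_rfl,
    Multiset.count_filter_of_pos le_rfl] at this

theorem MapInv.congr {u : ℕ} {T B B' : Fin n → Bunch} {φ : Fin n ≃. Fin n} (h : MapInv u T B φ)
    (hB : ∀ x, atLeast u (B' x) = atLeast u (B x)) : MapInv u T B' φ where
  gt x y hxy := (filter_lt_eq (hB x)).trans (h.gt x y hxy)
  left x hx := h.left x (by simpa only [← mem_atLeast, hB] using hx)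
  right := h.right

theorem totalDeficit_congr {u : ℕ} {T B B' : Fin n → Bunch} {φ : Fin n ≃. Fin n}
    (hB : ∀ x, (B' x).count u = (B x).count u) :
    totalDeficit u T B' φ = totalDeficit u T B φ := by
  simp only [totalDeficit, hB]

theorem atLeast_exchange {u : ℕ} (B : Fin n → Bunch) {x y : Fin n} (h : x ≠ y) {M : Multiset ℕ}
    (hM : ∀ v ∈ M, v < u) (z : Fin n) : atLeast u (exchange B x y M 0 z) = atLeast u (B z) := by
  have hM0 : M.filter (fun v => u ≤ v) = 0 := Multiset.filter_eq_nil.2 fun v hv => (hM v hv).not_ge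
  by_cases hzx : z = x
  · subst hzx
    rw [exchange_left _ h, add_zero, atLeast, Multiset.filter_sub, hM0, tsub_zero, atLeast]
  by_cases hzy : z = y
  · subst hzy
    rw [exchange_right, tsub_zero, atLeast, Multiset.filter_add, hM0, add_zero, atLeast]
  · rw [exchange_of_ne _ hzx hzy]

/-! ### Moving an item from a surplus bunch to a deficit bunch -/

/-- No item larger than `u` changes its bunch, and both altered bunches already lie in the domain of
`φ`. -/
theorem MapInv.exchange {u : ℕ} {T B : Fin n → Bunch} {φ : Fin n ≃. Fin n} (h : MapInv u T B φ)
    {s d : Fin n} (hs : Surplus u T B φ s) (hd : Deficit u T B φ d) {N : Multiset ℕ}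
    (hN : ∀ v ∈ N, v < u) : MapInv u T (exchange B s d {u} N) φ := by
  have hne := hs.ne hd
  have hN0 : N.filter (u < ·) = 0 := Multiset.filter_eq_nil.2 fun v hv => (hN v hv).not_gt
  have hu0 : ({u} : Multiset ℕ).filter (u < ·) = 0 := Multiset.filter_eq_nil.2 (by simp)
  refine ⟨fun x y hxy => ?_, fun x hx => ?_, h.right⟩
  · rw [← h.gt x y hxy]
    by_cases hxs : x = s
    · subst hxs
      rw [exchange_left _ hne, Multiset.filter_add, Multiset.filter_sub, hN0, hu0, tsub_zero, add_zero]
    by_cases hxd : x = d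
    · subst hxd
      rw [exchange_right, Multiset.filter_add, Multiset.filter_sub, hN0, hu0, tsub_zero, add_zero]
    · rw [exchange_of_ne _ hxs hxd]
  · by_cases hxs : x = s
    · subst hxs
      exact hs.imp fun y hy => hy.1
    by_cases hxd : x = d
    · subst hxd
      exact hd.imp fun y hy => hy.1
    · rw [exchange_of_ne _ hxs hxd] at hx
      exact h.left x hx

/-- The deficit bunch contributes one less. The surplus bunch had at least one item too many, so its
truncated difference is 0 before and after. -/
theorem totalDeficit_exchange {u : ℕ} {T B : Fin n → Bunch} {φ : Fin n ≃. Fin n}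
    {s d : Fin n} (hs : Surplus u T B φ s) (hd : Deficit u T B φ d) {N : Multiset ℕ}
    (hN : ∀ v ∈ N, v < u) :
    totalDeficit u T (exchange B s d {u} N) φ + 1 = totalDeficit u T B φ := by
  have hne := hs.ne hd
  have hN0 : N.count u = 0 := Multiset.count_eq_zero.2 fun hu => (hN u hu).ne rfl
  obtain ⟨y, hy, hlt⟩ := hs
  obtain ⟨y', hy', hlt'⟩ := hd
  rw [totalDeficit, totalDeficit, sum_split _ hne, sum_split _ hne, exchange_left _ hne,
    exchange_right, Option.mem_def.1 hy, Option.mem_def.1 hy']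
  have hrest : ∀ x ∈ (Finset.univ.erase s).erase d,
      (φ x).elim 0 (fun y => (T y).count u - (SettleItems.exchange B s d {u} N x).count u)
        = (φ x).elim 0 fun y => (T y).count u - (B x).count u := by
    intro x hx
    rw [exchange_of_ne _ (Finset.ne_of_mem_erase (Finset.mem_of_mem_erase hx))
      (Finset.ne_of_mem_erase hx)]
  rw [Finset.sum_congr rfl hrest]
  simp only [Option.elim_some, Multiset.count_add, Multiset.count_sub, hN0, Multiset.count_singleton_self]
  omega

/-! ### The invariants of the Action Step -/

/-- The total number of slack items. -/
def numSlackItems (κ : ℕ) (B : Fin n → Bunch) : ℕ := ∑ x, (slackItems κ (B x)).card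

/-- The assumptions on the instance: `K` is the total slack. -/
structure Setting (κ : ℕ) (T : Fin n → Bunch) (K : ℕ) : Prop where
  two_pow : ∃ a, κ = 2 ^ a
  legal : ∀ y, vol (T y) ≤ κ
  pow : ∀ v ∈ ∑ x, T x, ∃ k, v = 2 ^ k
  slack : ∀ B, Good κ T B → ∑ x, slack κ (B x) = K

structure ActInv (κ : ℕ) (T : Fin n → Bunch) (K i : ℕ) (B : Fin n → Bunch)
    (φ : Fin n ≃. Fin n) : Prop where
  good : Good κ T B
  stage : i < numStages T
  le : itemSize T i ≤ K
  map : MapInv (itemSize T i) T B φ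

structure PairInv (κ : ℕ) (T : Fin n → Bunch) (K i : ℕ) (B : Fin n → Bunch)
    (φ : Fin n ≃. Fin n) (s d : Fin n) : Prop extends ActInv κ T K i B φ where
  surplus : Surplus (itemSize T i) T B φ s
  deficit : Deficit (itemSize T i) T B φ d

variable {κ K i : ℕ} {T B : Fin n → Bunch} {φ : Fin n ≃. Fin n} {s d : Fin n}

theorem Setting.pow_of_mem (hI : Setting κ T K) (hB : Good κ T B) (x : Fin n) :
    ∀ v ∈ B x, ∃ k, v = 2 ^ k := fun v hv => hI.pow v (hB.mem hv)

theorem PairInv.itemSize_le (h : PairInv κ T K i B φ s d) : itemSize T i ≤ κ :=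
  (Multiset.le_sum_of_mem h.surplus.mem).trans (h.good.legal s)

theorem Mergeable.two_pow_lt (hI : Setting κ T K) (hi : i < numStages T) {x y : Fin n} {q : ℕ}
    (h : Mergeable κ B (itemSize T i) x y q) : 2 ^ q < itemSize T i := by
  obtain ⟨k, hk⟩ := hI.pow _ (itemSize_mem hi)
  have hq := h.2.1
  rw [hk] at hq ⊢
  rw [Nat.log_pow (by norm_num)] at hq
  exact Nat.pow_lt_pow_right (by norm_num) hq

theorem PairInv.bundleInput_of_mergeable (h : PairInv κ T K i B φ s d) {x y : Fin n} {q : ℕ}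
    (hm : Mergeable κ B (itemSize T i) x y q) : BundleInput κ (B x) q := by
  refine ⟨hm.2.1.trans_le (Nat.log_mono_right h.itemSize_le), .slack (2 ^ q), ?_, le_rfl⟩
  exact Multiset.mem_add.2 (Or.inr (Multiset.mem_map_of_mem _ hm.2.2.1))

/-- After compression, slack items all smaller than the current size would sum to less than that
size, contrary to `h.le`. -/
theorem PairInv.exists_host (hI : Setting κ T K) (h : PairInv κ T K i B φ s d)
    (hm : ∀ x y q, ¬ Mergeable κ B (itemSize T i) x y q) :
    ∃ t, ∃ v ∈ slackItems κ (B t), itemSize T i ≤ v := by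
  by_contra hno
  push Not at hno
  obtain ⟨k, hk⟩ := hI.pow _ (itemSize_mem h.stage)
  have hle := h.le
  rw [hk] at hm hno hle
  have := sum_slack_lt B hm hno
  rw [hI.slack B h.good] at this
  omega

/-- A full or nearly full deficit bunch contains an actual or slack item below the current size. -/
theorem PairInv.exists_small (hI : Setting κ T K) (h : PairInv κ T K i B φ s d)
    (hd : ¬ itemSize T i ≤ slack κ (B d)) : ∃ e ∈ allElems κ (B d), e.size < itemSize T i := by
  by_contra hno
  push Not at hno
  have h0 : slack κ (B d) = 0 := by
    -- A slack item would have size at least that of the current item, yet it is bounded by the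
    -- slack, which is smaller.
    rw [← sum_slackItems]
    rcases Multiset.empty_or_exists_mem (slackItems κ (B d)) with h0 | ⟨v, hv⟩
    · rw [h0]; rfl
    · have h1 := hno (.slack v) (Multiset.mem_add.2 (Or.inr (Multiset.mem_map_of_mem _ hv)))
      exact absurd (h1.trans (le_slack_of_mem_slackItems hv)) hd
  have hall : atLeast (itemSize T i) (B d) = B d := Multiset.filter_eq_self.2 fun v hv =>
    hno (.actual v) (Multiset.mem_add.2 (Or.inl (Multiset.mem_map_of_mem _ hv)))
  obtain ⟨y, hy, hlt⟩ := h.deficit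
  obtain ⟨k, hk⟩ := hI.pow _ (itemSize_mem h.stage)
  have hpos : 0 < itemSize T i := hk ▸ Nat.two_pow_pos k
  have hTy : (atLeast (itemSize T i) (T y)).sum ≤ vol (T y) := by
    obtain ⟨R, hR⟩ := Multiset.le_iff_exists_add.1 (Multiset.filter_le (itemSize T i ≤ ·) (T y))
    rw [vol]
    conv_rhs => rw [hR]
    rw [Multiset.sum_add]
    exact Nat.le_add_right _ _
  -- The image has the same larger items and more items of the current size, so it would overflow if
  -- `B d` were full.
  have hB : vol (B d) < (atLeast (itemSize T i) (T y)).sum := by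
    rw [vol, ← hall, atLeast_eq_filter_add, atLeast_eq_filter_add, h.map.gt d y hy,
      Multiset.sum_add, Multiset.sum_add, Multiset.sum_replicate, Multiset.sum_replicate,
      smul_eq_mul, smul_eq_mul]
    exact Nat.add_lt_add_left (Nat.mul_lt_mul_of_pos_right hlt hpos) _
  have := hI.legal y
  simp only [slack] at h0
  omega

/-- An actual or slack item below the current size `u` is a smaller power of two; hence `u ≠ 1` and
the item is at most `u / 2`. -/
theorem PairInv.exists_bundleInput (hI : Setting κ T K) (h : PairInv κ T K i B φ s d)
    (hd : ¬ itemSize T i ≤ slack κ (B d)) :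
    ∃ p, 2 ^ (p + 1) = itemSize T i ∧ BundleInput κ (B d) p := by
  obtain ⟨e, he, hlt⟩ := h.exists_small hI hd
  obtain ⟨k, hk⟩ := hI.pow _ (itemSize_mem h.stage)
  obtain ⟨j, hj⟩ := allElems_pow (hI.pow_of_mem h.good d) e he
  have hle := h.itemSize_le
  rw [hk] at hlt hle
  rw [hj] at hlt
  have hjk := (Nat.pow_lt_pow_iff_right (by norm_num)).1 hlt
  obtain ⟨p, rfl⟩ : ∃ p, k = p + 1 := ⟨k - 1, by omega⟩
  refine ⟨p, hk.symm, ?_, e, he, ?_⟩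
  · have := Nat.log_mono_right (b := 2) hle
    rw [Nat.log_pow (by norm_num)] at this
    omega
  · rw [hj]
    exact Nat.pow_le_pow_right (by norm_num) (by omega)

/-! ### The compression phase -/

theorem numSlackItems_exchange_lt (hI : Setting κ T K) (hB : Good κ T B) {x y : Fin n} {q : ℕ}
    (hxy : x ≠ y) (hx : 2 ^ q ∈ slackItems κ (B x)) (hy : 2 ^ q ∈ slackItems κ (B y)) {b : Bundle}
    (hb : b ≤ allElems κ (B x)) (hsum : bsum b = 2 ^ q) (hne : actualItems b ≠ 0) :
    numSlackItems κ (exchange B x y (actualItems b) 0) < numSlackItems κ B := by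
  have hle : (actualItems b).sum ≤ slack κ (B y) := by
    have := le_slack_of_mem_slackItems hy
    rw [bsum_eq] at hsum
    omega
  have h1 := (slack_exchange_left B hxy (actualItems_le hb) (hB.legal x) (N := 0) (by simp)).2
  have h2 := (slack_exchange_right B hxy (Multiset.zero_le _) (hB.legal y) (M := actualItems b)
    (by simpa using hle)).2
  have h3 := card_slackItems_lt_of_move (hI.pow_of_mem hB x) hb hsum hne hx hy
    (B' := exchange B x y (actualItems b) 0 x) (D' := exchange B x y (actualItems b) 0 y)
    (by simpa using h1) (by simpa using h2.symm)
  rw [numSlackItems, numSlackItems, sum_split _ hxy, sum_split (fun z => (slackItems κ (B z)).card) hxy]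
  have hrest : ∀ z ∈ (Finset.univ.erase x).erase y,
      (slackItems κ (exchange B x y (actualItems b) 0 z)).card = (slackItems κ (B z)).card := by
    intro z hz
    rw [exchange_of_ne _ (Finset.ne_of_mem_erase (Finset.mem_of_mem_erase hz))
      (Finset.ne_of_mem_erase hz)]
  rw [Finset.sum_congr rfl hrest]
  exact Nat.add_lt_add_right h3 _

/-- The moved items fit into the slack item `2 ^ p` of the recipient. They are smaller than the
current size, so surplus and deficit are unaffected. -/
theorem PairInv.mergeMoves (hI : Setting κ T K) (h : PairInv κ T K i B φ s d) {x y : Fin n}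
    {p : ℕ} (hm : Mergeable κ B (itemSize T i) x y p) {b₁ b₂ : Bundle} {R : Multiset Bundle}
    (hL : BundleInv κ (B x) p p (b₁ ::ₘ b₂ ::ₘ R)) (h₁ : bsum b₁ = 2 ^ p) (h₂ : bsum b₂ = 2 ^ p)
    {l : List ℕ}
    (hl : (l : Multiset ℕ) = if actualItems b₁ ≠ 0 then actualItems b₁ else actualItems b₂) :
    ∃ B', Runs κ B (l.map fun v => ⟨v, x, y⟩) B' ∧ PairInv κ T K i B' φ s d ∧
      totalDeficit (itemSize T i) T B' φ = totalDeficit (itemSize T i) T B φ ∧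
      numSlackItems κ B' < numSlackItems κ B := by
  have hpair := hL.pair_le
  obtain ⟨b, hb, hsum, hne, hlb⟩ : ∃ b, b ≤ allElems κ (B x) ∧ bsum b = 2 ^ p ∧
      actualItems b ≠ 0 ∧ (l : Multiset ℕ) = actualItems b := by
    by_cases h0 : actualItems b₁ = 0
    · exact ⟨b₂, (Multiset.le_add_left _ _).trans hpair, h₂,
        actualItems_ne_zero_of_pair hpair h₁ h₂ h0, by simpa [h0] using hl⟩
    · exact ⟨b₁, (Multiset.le_add_right _ _).trans hpair, h₁, h0, by simpa [h0] using hl⟩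
  have hle : (actualItems b).sum ≤ 2 ^ p := by
    rw [bsum_eq] at hsum
    omega
  have hfit : l.sum ≤ slack κ (B y) := by
    rw [← Multiset.sum_coe, hlb]
    exact hle.trans (le_slack_of_mem_slackItems hm.2.2.2)
  have hlt : ∀ v ∈ (l : Multiset ℕ), v < itemSize T i := fun v hv =>
    ((Multiset.le_sum_of_mem hv).trans (hlb ▸ hle)).trans_lt (hm.two_pow_lt hI h.stage)
  have hrun := runs_map l hm.1 (hlb ▸ actualItems_le hb) hfit
  have hat := atLeast_exchange B hm.1 hlt
  have hcount := fun z => count_eq_of_atLeast_eq (hat z)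
  refine ⟨_, hrun, ⟨⟨h.good.runs hrun, h.stage, h.le, h.map.congr hat⟩, ?_, ?_⟩,
    totalDeficit_congr hcount, ?_⟩
  · obtain ⟨z, hz, hc⟩ := h.surplus
    exact ⟨z, hz, (hcount s).symm ▸ hc⟩
  · obtain ⟨z, hz, hc⟩ := h.deficit
    exact ⟨z, hz, (hcount d).symm ▸ hc⟩
  · rw [hlb]
    exact numSlackItems_exchange_lt hI h.good hm.1 hm.2.2.1 hm.2.2.2 hb hsum hne

/-! ### The transfer phase -/

theorem PairInv.exchange (h : PairInv κ T K i B φ s d) {N : Multiset ℕ}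
    (hN : ∀ v ∈ N, v < itemSize T i)
    (hg : Good κ T (SettleItems.exchange B s d {itemSize T i} N)) :
    ActInv κ T K i (SettleItems.exchange B s d {itemSize T i} N) φ :=
  ⟨hg, h.stage, h.le, h.map.exchange h.surplus h.deficit hN⟩

theorem PairInv.direct (h : PairInv κ T K i B φ s d) (hd : itemSize T i ≤ slack κ (B d)) :
    ∃ B', Runs κ B [⟨itemSize T i, s, d⟩] B' ∧ ActInv κ T K i B' φ ∧
      totalDeficit (itemSize T i) T B' φ + 1 = totalDeficit (itemSize T i) T B φ := by
  have hne := h.surplus.ne h.deficit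
  have hB' : applyMove B ⟨itemSize T i, s, d⟩
      = SettleItems.exchange B s d {itemSize T i} 0 := by
    rw [applyMove, if_neg hne, moveItem_eq_exchange]
  have hrun : Runs κ B [⟨itemSize T i, s, d⟩]
      (SettleItems.exchange B s d {itemSize T i} 0) :=
    .cons ⟨h.surplus.mem, fun _ => hd⟩ (hB' ▸ .nil _)
  exact ⟨_, hrun, h.exchange (by simp) (h.good.runs hrun),
    totalDeficit_exchange h.surplus h.deficit (by simp)⟩

/-- The invariant of the indirect transfer, about the bunches `B` before the item was moved to the
temporary host. -/
structure HostInv (κ : ℕ) (T : Fin n → Bunch) (K i : ℕ) (B : Fin n → Bunch)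
    (φ : Fin n ≃. Fin n) (s d t : Fin n) : Prop extends PairInv κ T K i B φ s d where
  host : itemSize T i ≤ slack κ (B t)
  full : ¬ itemSize T i ≤ slack κ (B d)

variable {t : Fin n}

theorem HostInv.ne (h : HostInv κ T K i B φ s d t) : t ≠ d := by
  rintro rfl
  exact h.full h.host

theorem HostInv.runs (h : HostInv κ T K i B φ s d t) :
    Runs κ B [⟨itemSize T i, s, t⟩] (applyMove B ⟨itemSize T i, s, t⟩) :=
  .cons ⟨h.surplus.mem, fun _ => h.host⟩ (.nil _)

/-- The deficit bunch is neither donor nor host, so its bundles can be analysed in the bunches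
before the first move. -/
theorem HostInv.applyMove_deficit (h : HostInv κ T K i B φ s d t) :
    applyMove B ⟨itemSize T i, s, t⟩ d = B d := by
  rw [applyMove]
  split_ifs
  · rfl
  · simp [moveItem, h.ne.symm, (h.surplus.ne h.deficit).symm]

/-- The host drops out of the balance: the net effect is to exchange one item of the current size at
`s` for the actual items of the two bundles at `d`. This includes `t = s`, where the first move does
nothing. -/
theorem HostInv.transferMoves (h : HostInv κ T K i B φ s d t) {p : ℕ}
    (hp : 2 ^ (p + 1) = itemSize T i) {b₁ b₂ : Bundle} {R : Multiset Bundle}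
    (hL : BundleInv κ (B d) p p (b₁ ::ₘ b₂ ::ₘ R)) (h₁ : bsum b₁ = 2 ^ p) (h₂ : bsum b₂ = 2 ^ p)
    {l : List ℕ} (hl : (l : Multiset ℕ) = actualItems b₁ + actualItems b₂) :
    ∃ B', Runs κ (applyMove B ⟨itemSize T i, s, t⟩)
        (l.map (fun v => ⟨v, d, s⟩) ++ [⟨itemSize T i, t, d⟩]) B' ∧ ActInv κ T K i B' φ ∧
      totalDeficit (itemSize T i) T B' φ + 1 = totalDeficit (itemSize T i) T B φ := by
  have hne := h.surplus.ne h.deficit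
  have htd := h.ne
  have hus := h.surplus.mem
  have hBd := h.applyMove_deficit
  have hgood := h.good.runs h.runs
  set u := itemSize T i with hu
  set B₁ := applyMove B ⟨u, s, t⟩ with hB₁
  have hpair := hL.pair_le
  have hlle : (l : Multiset ℕ) ≤ B d := by
    rw [hl, ← actualItems_add]
    exact actualItems_le hpair
  have hsum : (l : Multiset ℕ).sum + (slackPart (b₁ + b₂)).sum = u := by
    rw [hl, ← actualItems_add, ← bsum_eq, bsum_add, h₁, h₂, ← hp]
    ring
  have hlt : ∀ v ∈ (l : Multiset ℕ), v < u := by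
    have hpu : 2 ^ p < u := hp ▸ Nat.pow_lt_pow_right (by norm_num) (Nat.lt_succ_self p)
    intro v hv
    rw [hl] at hv
    rw [bsum_eq] at h₁ h₂
    rcases Multiset.mem_add.1 hv with hv | hv
    · have := Multiset.le_sum_of_mem hv
      omega
    · have := Multiset.le_sum_of_mem hv
      omega
  -- The slack part of the two bundles is already free in `B d`, and moving out their actual part
  -- frees the rest of `u`.
  have hslack : u ≤ slack κ (B d) + (l : Multiset ℕ).sum := by
    obtain ⟨Q, hQ⟩ := Multiset.le_iff_exists_add.1 (slackPart_le hpair)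
    have hs := sum_slackItems κ (B d)
    rw [hQ, Multiset.sum_add] at hs
    omega
  -- Either `s` is the host and has slack at least `u`, or it has just given away an item of size
  -- `u`.
  have hfit : l.sum ≤ slack κ (B₁ s) := by
    have hlu : l.sum ≤ u := by
      rw [← Multiset.sum_coe]
      omega
    refine hlu.trans ?_
    rw [hB₁, applyMove]
    split_ifs with hst
    · obtain rfl : s = t := hst
      exact h.host
    · obtain ⟨A, hA⟩ := Multiset.exists_cons_of_mem hus
      have hleg := h.good.legal s
      have : moveItem B u s t s = A := by
        rw [moveItem, Function.update_of_ne hst, Function.update_self, hA,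
          Multiset.erase_cons_head]
      rw [this]
      rw [hA, vol, Multiset.sum_cons] at hleg
      simp only [slack, vol]
      omega
  have hrun₁ := runs_map l hne.symm (hBd ▸ hlle) hfit
  set B₂ := SettleItems.exchange B₁ d s l 0 with hB₂
  have hsl := (slack_exchange_left B₁ hne.symm (hBd ▸ hlle) (hgood.legal d) (N := 0) (by simp)).2
  have hut : u ∈ B₂ t := by
    by_cases hst : s = t
    · subst hst
      have : B₁ = B := if_pos rfl
      rw [hB₂, exchange_right, this, tsub_zero]
      exact Multiset.mem_add.2 (Or.inl hus)
    · have : B₁ = moveItem B u s t := if_neg hst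
      rw [hB₂, exchange_of_ne _ htd (Ne.symm hst), this]
      simp [moveItem]
  have hB₃ : applyMove B₂ ⟨u, t, d⟩ = SettleItems.exchange B s d {u} l := by
    have e : applyMove B₂ ⟨u, t, d⟩ = moveItem B₂ u t d := if_neg htd
    rw [e, moveItem_eq_exchange]
    funext z
    by_cases hzd : z = d
    · subst hzd
      rw [exchange_right, exchange_right, hB₂, exchange_left _ hne.symm, hBd, add_zero, tsub_zero]
    by_cases hst : s = t
    · subst hst
      have : B₁ = B := if_pos rfl
      by_cases hzs : z = s
      · subst hzs
        rw [exchange_left _ hne, exchange_left _ hne, hB₂, exchange_right, this, tsub_zero, add_zero,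
          Multiset.sub_singleton, Multiset.sub_singleton, Multiset.erase_add_left_pos _ hus]
      · rw [exchange_of_ne _ hzs hzd, exchange_of_ne _ hzs hzd, hB₂, exchange_of_ne _ hzd hzs, this]
    · have : B₁ = moveItem B u s t := if_neg hst
      by_cases hzs : z = s
      · subst hzs
        rw [exchange_of_ne _ hst hne, exchange_left _ hne, hB₂, exchange_right, this, tsub_zero,
          moveItem_eq_exchange, exchange_left _ hst, add_zero]
      by_cases hzt : z = t
      · subst hzt
        rw [exchange_left _ htd, exchange_of_ne _ hzs hzd, hB₂, exchange_of_ne _ hzd hzs, this,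
          moveItem_eq_exchange, exchange_right]
        simp
      · rw [exchange_of_ne _ hzt hzd, exchange_of_ne _ hzs hzd, hB₂, exchange_of_ne _ hzd hzs, this,
          moveItem_eq_exchange, exchange_of_ne _ hzs hzt]
  have hrun₂ : Runs κ B₂ [⟨u, t, d⟩] (SettleItems.exchange B s d {u} l) := by
    refine .cons ⟨hut, fun _ => ?_⟩ (hB₃ ▸ .nil _)
    change u ≤ slack κ (B₂ d)
    rw [Multiset.sum_zero, add_zero, hBd] at hsl
    rw [hB₂, hsl]
    exact hslack
  have hrun := hrun₁.append hrun₂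
  exact ⟨_, hrun, h.exchange hlt (hgood.runs hrun),
    totalDeficit_exchange h.surplus h.deficit hlt⟩

end SettleItems

namespace SettleItems

variable {n : ℕ}

/-! ### The invariant of the algorithm, and a rank that decreases -/

/-- The components measure the remaining stages (doubled, to separate the mapping from the action),
the total deficit, the point within the loop, the number of slack items (doubled, to separate
forming bundles from starting a merge), and the work left in forming bundles. An indirect transfer
counts its deficit as reduced from the start, hence the high codes 4 and 3 in the third place. -/
abbrev Rank := ℕ ×ₗ ℕ ×ₗ ℕ ×ₗ ℕ ×ₗ ℕ

def rank (a b c d e : ℕ) : Rank := toLex (a, toLex (b, toLex (c, toLex (d, e))))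

theorem rank_lt_rank {a b c d e a' b' c' d' e' : ℕ} :
    rank a b c d e < rank a' b' c' d' e' ↔
      a < a' ∨ a = a' ∧ (b < b' ∨ b = b' ∧ (c < c' ∨ c = c' ∧ (d < d' ∨ d = d' ∧ e < e'))) := by
  simp [rank, Prod.Lex.toLex_lt_toLex]

/-- The invariant of stage `i` when no moves are pending, with the rank of the point of the program
that has been reached. -/
inductive PhaseInv (κ : ℕ) (T : Fin n → Bunch) (K i : ℕ) :
    (Fin n → Bunch) → Phase n → Rank → Prop
  | stage {B : Fin n → Bunch} (hg : Good κ T B) (hi : i ≤ numStages T) (hs : PrevSettled B T i)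
      (hl : largestUnsettled (config B) (config T) ≤ K) :
      PhaseInv κ T K i B .stage (rank (2 * (numStages T - i) + 1) 0 0 0 0)
  | action {B : Fin n → Bunch} {φ : Fin n ≃. Fin n} (h : ActInv κ T K i B φ) :
      PhaseInv κ T K i B (.action φ)
        (rank (2 * (numStages T - i)) (totalDeficit (itemSize T i) T B φ) 2 0 0)
  | compress {B : Fin n → Bunch} {φ : Fin n ≃. Fin n} {s d : Fin n} (h : PairInv κ T K i B φ s d) :
      PhaseInv κ T K i B (.compress φ s d)
        (rank (2 * (numStages T - i)) (totalDeficit (itemSize T i) T B φ) 1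
          (2 * numSlackItems κ B + 1) 0)
  | merge {B : Fin n → Bunch} {φ : Fin n ≃. Fin n} {s d x y : Fin n} {p j : ℕ}
      {L : Multiset Bundle} (h : PairInv κ T K i B φ s d)
      (hm : Mergeable κ B (itemSize T i) x y p) (hL : BundleInv κ (B x) p j L) :
      PhaseInv κ T K i B (.bundles φ s d x p j L (.mergeInto y))
        (rank (2 * (numStages T - i)) (totalDeficit (itemSize T i) T B φ) 1
          (2 * numSlackItems κ B) (p - j + L.card))
  | transfer {B₀ B : Fin n → Bunch} {φ : Fin n ≃. Fin n} {s d t : Fin n}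
      (h : HostInv κ T K i B₀ φ s d t) (hB : B = applyMove B₀ ⟨itemSize T i, s, t⟩) :
      PhaseInv κ T K i B (.transfer φ s d t)
        (rank (2 * (numStages T - i)) (totalDeficit (itemSize T i) T B₀ φ - 1) 4 0 0)
  | transferBundles {B₀ B : Fin n → Bunch} {φ : Fin n ≃. Fin n} {s d t : Fin n} {p j : ℕ}
      {L : Multiset Bundle} (h : HostInv κ T K i B₀ φ s d t)
      (hB : B = applyMove B₀ ⟨itemSize T i, s, t⟩) (hp : 2 ^ (p + 1) = itemSize T i)
      (hL : BundleInv κ (B₀ d) p j L) :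
      PhaseInv κ T K i B (.bundles φ s d d p j L (.transfer t))
        (rank (2 * (numStages T - i)) (totalDeficit (itemSize T i) T B₀ φ - 1) 3 0
          (p - j + L.card))

/-- The invariant of a state: the pending moves can be carried out, and lead to bunches that
satisfy the invariant of the point of the program. -/
def StateInv (κ : ℕ) (T : Fin n → Bunch) (K : ℕ) (σ : State n) (r : Rank ×ₗ ℕ) : Prop :=
  Good κ T σ.bunch ∧ ∃ B r', Runs κ σ.bunch σ.todo B ∧ PhaseInv κ T K σ.index B σ.phase r' ∧
    r = toLex (r', σ.todo.length)

theorem PhaseInv.stateInv {κ K i : ℕ} {T B : Fin n → Bunch} {ph : Phase n} {r : Rank}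
    (hg : Good κ T B) (h : PhaseInv κ T K i B ph r) :
    StateInv κ T K ⟨B, [], i, ph⟩ (toLex (r, 0)) :=
  ⟨hg, B, r, .nil B, h, rfl⟩

variable {κ K : ℕ} {T : Fin n → Bunch}

/-- An instruction leads to bunches that satisfy the invariant, with a smaller rank, once the moves
have been carried out. -/
theorem exists_stateInv_lt {B B' : Fin n → Bunch} {ms : List (Move n)} {i : ℕ} {ph : Phase n}
    {r r' : Rank} (hg : Good κ T B) (hr : Runs κ B ms B') (h : PhaseInv κ T K i B' ph r')
    (hlt : r' < r) : ∃ q < toLex (r, 0), StateInv κ T K ⟨B, ms, i, ph⟩ q :=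
  ⟨toLex (r', ms.length), Prod.Lex.toLex_lt_toLex.2 (Or.inl hlt), hg, B', r', hr, h, rfl⟩

theorem StateInv.step (hI : Setting κ T K) {σ τ : State n} {r : Rank ×ₗ ℕ}
    (hσ : StateInv κ T K σ r) (hst : Step κ T σ τ) : ∃ r' < r, StateInv κ T K τ r' := by
  obtain ⟨hg, B', r', hruns, hph, rfl⟩ := hσ
  cases hst with
  | move B u x y ms i ph hxy hu hfit =>
    dsimp only at hg hruns hph ⊢
    cases hruns with
    | cons hc hr =>
      have hm : applyMove B ⟨u, x, y⟩ = moveItem B u x y := if_neg hxy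
      rw [hm] at hr
      exact ⟨toLex (r', ms.length), Prod.Lex.toLex_lt_toLex.2 (Or.inr ⟨rfl, Nat.lt_succ_self _⟩),
        hg.moveItem hxy hu hfit, B', r', hr, hph, rfl⟩
  | moveSelf B u x ms i ph hu =>
    dsimp only at hg hruns hph ⊢
    cases hruns with
    | cons hc hr =>
      have hm : applyMove B ⟨u, x, x⟩ = B := if_pos rfl
      rw [hm] at hr
      exact ⟨toLex (r', ms.length), Prod.Lex.toLex_lt_toLex.2 (Or.inr ⟨rfl, Nat.lt_succ_self _⟩),
        hg, B', r', hr, hph, rfl⟩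
  | skip B i hi hl =>
    dsimp only at hg hruns hph ⊢
    cases hruns
    cases hph with
    | stage _ _ hs hlK =>
      refine exists_stateInv_lt hg (.nil _) (.stage hg hi ?_ hlK) (rank_lt_rank.2 (by omega))
      intro k hk
      obtain rfl : i = k := by omega
      by_contra hns
      refine hl.not_ge (le_largestUnsettled ?_ hns)
      rw [underlying_config, hg.items]
      exact itemSize_mem hi
  | choose B i φ hi hl hφ =>
    dsimp only at hg hruns hph ⊢
    cases hruns
    cases hph with
    | stage _ _ hs hlK =>
      exact exists_stateInv_lt hg (.nil _)
        (.action ⟨hg, hi, (not_lt.1 hl).trans hlK, hφ.mapInv hi hg.items⟩)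
        (rank_lt_rank.2 (by omega))
  | actionExit B i φ hc =>
    dsimp only at hg hruns hph ⊢
    cases hruns
    cases hph with
    | action h =>
      have hset := h.map.settled hc
      have hi := h.stage
      refine exists_stateInv_lt hg (.nil _) (.stage hg h.stage ?_ ?_) (rank_lt_rank.2 (by omega))
      · intro k hk
        obtain rfl : i = k := by omega
        exact hset
      -- All sizes from the current one upwards are now settled, so any unsettled size is at most
      -- the current one and hence at most `K`.
      · refine largestUnsettled_le fun v _ hv => ?_
        refine le_trans ?_ h.le
        exact le_of_not_ge fun hle => hv (settled_mono hle hset)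
  | actionEnter B i φ s d s₁ d₁ hs hs' hd hd' =>
    dsimp only at hg hruns hph ⊢
    cases hruns
    cases hph with
    | action h =>
      exact exists_stateInv_lt hg (.nil _) (.compress ⟨h, ⟨s₁, hs, hs'⟩, ⟨d₁, hd, hd'⟩⟩)
        (rank_lt_rank.2 (by omega))
  | mergeStart B i φ s d x y q hm hin =>
    dsimp only at hg hruns hph ⊢
    cases hruns
    cases hph with
    | compress h =>
      exact exists_stateInv_lt hg (.nil _) (.merge h hm (.init (hI.pow_of_mem hg x) hin))
        (rank_lt_rank.2 (by omega))
  | direct B i φ s d t hm ht hd =>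
    dsimp only at hg hruns hph ⊢
    cases hruns
    cases hph with
    | compress h =>
      obtain ⟨B', hr, hB', hdef⟩ := h.direct hd
      exact exists_stateInv_lt hg hr (.action hB') (rank_lt_rank.2 (by omega))
  | toTemp B i φ s d t hm ht hd =>
    dsimp only at hg hruns hph ⊢
    cases hruns
    cases hph with
    | compress h =>
      obtain ⟨v, hv, huv⟩ := ht
      have hh : HostInv κ T K i _ φ s d t :=
        ⟨h, huv.trans (le_slack_of_mem_slackItems hv), hd⟩
      -- This only serves to show that the deficit is positive, so that its truncated predecessor is
      -- strictly smaller.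
      have hdef := totalDeficit_exchange h.surplus h.deficit (N := 0) (by simp)
      exact exists_stateInv_lt hg hh.runs (.transfer hh rfl) (rank_lt_rank.2 (by omega))
  | transferStart B i φ s d t p hp hin =>
    dsimp only at hg hruns hph ⊢
    cases hruns
    cases hph with
    | transfer h hB =>
      have hd := congrFun hB d
      rw [h.applyMove_deficit] at hd
      rw [hd] at hin ⊢
      exact exists_stateInv_lt hg (.nil _)
        (.transferBundles h hB hp (.init (hI.pow_of_mem h.good d) hin)) (rank_lt_rank.2 (by omega))
  | bundleMerge B i φ s d x p j b₁ b₂ R g hj h₁ h₂ =>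
    dsimp only at hg hruns hph ⊢
    cases hruns
    cases hph with
    | merge h hm hL =>
      exact exists_stateInv_lt hg (.nil _) (.merge h hm (hL.merge hj h₁ h₂))
        (rank_lt_rank.2 (by simp))
    | transferBundles h hB hp hL =>
      exact exists_stateInv_lt hg (.nil _) (.transferBundles h hB hp (hL.merge hj h₁ h₂))
        (rank_lt_rank.2 (by simp))
  | bundleNext B i φ s d x p j L g hj hn =>
    dsimp only at hg hruns hph ⊢
    cases hruns
    cases hph with
    | merge h hm hL =>
      exact exists_stateInv_lt hg (.nil _) (.merge h hm (hL.next hj hn))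
        (rank_lt_rank.2 (by omega))
    | transferBundles h hB hp hL =>
      exact exists_stateInv_lt hg (.nil _) (.transferBundles h hB hp (hL.next hj hn))
        (rank_lt_rank.2 (by omega))
  | mergeMoves B i φ s d x y p b₁ b₂ R l h₁ h₂ hl =>
    dsimp only at hg hruns hph ⊢
    cases hruns
    cases hph with
    | merge h hm hL =>
      obtain ⟨B', hr, hB', hdef, hlt⟩ := h.mergeMoves hI hm hL h₁ h₂ hl
      exact exists_stateInv_lt hg hr (.compress hB') (rank_lt_rank.2 (by omega))
  | transferMoves B i φ s d x t p b₁ b₂ R l h₁ h₂ hl =>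
    dsimp only at hg hruns hph ⊢
    cases hruns
    cases hph with
    | transferBundles h hB hp hL =>
      obtain ⟨B', hr, hB', hdef⟩ := h.transferMoves hp hL h₁ h₂ hl
      exact exists_stateInv_lt hg (hB ▸ hr) (.action hB') (rank_lt_rank.2 (by omega))

/-! ### Progress, and correctness of the final state -/

theorem exists_bundle_step {B : Fin n → Bunch} {i : ℕ} {φ : Fin n ≃. Fin n} {s d x : Fin n}
    {p j : ℕ} {L : Multiset Bundle} {g : Goal n} (hj : j < p) :
    ∃ τ, Step κ T ⟨B, [], i, .bundles φ s d x p j L g⟩ τ := by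
  by_cases h : ∃ (b₁ b₂ : Bundle) (R : Multiset Bundle),
      L = b₁ ::ₘ b₂ ::ₘ R ∧ bsum b₁ = 2 ^ j ∧ bsum b₂ = 2 ^ j
  · obtain ⟨b₁, b₂, R, rfl, h₁, h₂⟩ := h
    exact ⟨_, .bundleMerge B i φ s d x p j b₁ b₂ R g hj h₁ h₂⟩
  · exact ⟨_, .bundleNext B i φ s d x p j L g hj h⟩

/-- All instructions can be carried out. -/
theorem StateInv.exists_step (hI : Setting κ T K) {σ : State n} {r : Rank ×ₗ ℕ}
    (hσ : StateInv κ T K σ r) : (∃ τ, Step κ T σ τ) ∨ IsFinal T σ := by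
  obtain ⟨B, todo, i, ph⟩ := σ
  obtain ⟨hg, B', r', hruns, hph, -⟩ := hσ
  dsimp only at hg hruns hph
  cases hruns with
  | @cons _ _ m ms hc hr =>
    obtain ⟨u, x, y⟩ := m
    refine Or.inl ?_
    by_cases hxy : x = y
    · subst hxy
      exact ⟨_, .moveSelf B u x ms i ph hc.1⟩
    · exact ⟨_, .move B u x y ms i ph hxy hc.1 (hc.2 hxy)⟩
  | nil =>
    cases hph with
    | stage _ hi hs hl =>
      rcases Nat.lt_or_ge i (numStages T) with hi' | hi'
      · refine Or.inl ?_
        by_cases hlt : largestUnsettled (config B) (config T) < itemSize T i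
        · exact ⟨_, .skip B i hi' hlt⟩
        · obtain ⟨φ, hφ⟩ := exists_isStageMap hi' hg.items hs
          exact ⟨_, .choose B i φ hi' hlt hφ⟩
      · exact Or.inr ⟨rfl, rfl, le_antisymm hi hi'⟩
    | @action _ φ h =>
      refine Or.inl ?_
      by_cases hc : ∀ x y, y ∈ φ x → (B x).count (itemSize T i) = (T y).count (itemSize T i)
      · exact ⟨_, .actionExit B i φ hc⟩
      · obtain ⟨⟨s, s₁, hs, hs'⟩, d, d₁, hd, hd'⟩ := h.map.exists_surplus_deficit hg.items hc
        exact ⟨_, .actionEnter B i φ s d s₁ d₁ hs hs' hd hd'⟩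
    | @compress _ φ s d h =>
      refine Or.inl ?_
      by_cases hm : ∃ x y q, Mergeable κ B (itemSize T i) x y q
      · obtain ⟨x, y, q, hm⟩ := hm
        exact ⟨_, .mergeStart B i φ s d x y q hm (h.bundleInput_of_mergeable hm)⟩
      · have hm : ∀ x y q, ¬ Mergeable κ B (itemSize T i) x y q :=
          fun x y q hq => hm ⟨x, y, q, hq⟩
        obtain ⟨t, ht⟩ := h.exists_host hI hm
        by_cases hd : itemSize T i ≤ slack κ (B d)
        · exact ⟨_, .direct B i φ s d t hm ht hd⟩
        · exact ⟨_, .toTemp B i φ s d t hm ht hd⟩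
    | @merge _ φ s d x y p j L h hm hL =>
      refine Or.inl ?_
      rcases hL.le.lt_or_eq with hj | rfl
      · exact exists_bundle_step hj
      · obtain ⟨a, rfl⟩ := hI.two_pow
        obtain ⟨b₁, b₂, R, rfl, h₁, h₂⟩ := hL.exists_two (hg.legal x)
        exact ⟨_, .mergeMoves B i φ s d x y j b₁ b₂ R _ h₁ h₂ (Multiset.coe_toList _)⟩
    | @transfer B₀ _ φ s d t h hB =>
      obtain ⟨p, hp, hin⟩ := h.exists_bundleInput hI h.full
      have hd : B d = B₀ d := hB ▸ h.applyMove_deficit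
      exact Or.inl ⟨_, .transferStart B i φ s d t p hp (hd ▸ hin)⟩
    | @transferBundles B₀ _ φ s d t p j L h hB hp hL =>
      refine Or.inl ?_
      rcases hL.le.lt_or_eq with hj | rfl
      · exact exists_bundle_step hj
      · obtain ⟨a, rfl⟩ := hI.two_pow
        obtain ⟨b₁, b₂, R, rfl, h₁, h₂⟩ := hL.exists_two (h.good.legal d)
        exact ⟨_, .transferMoves B i φ s d d t j b₁ b₂ R _ h₁ h₂ (Multiset.coe_toList _)⟩

theorem StateInv.config_step {σ τ : State n} {r : Rank ×ₗ ℕ} (hσ : StateInv κ T K σ r)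
    (hst : Step κ T σ τ) :
    config σ.bunch = config τ.bunch ∨ Adjacent κ (config σ.bunch) (config τ.bunch) := by
  cases hst with
  | move B u x y ms i ph hxy hu hfit => exact hσ.1.adjacent_moveItem hxy hu hfit
  | _ => exact Or.inl rfl

theorem StateInv.config_eq {σ : State n} {r : Rank ×ₗ ℕ} (hσ : StateInv κ T K σ r)
    (hf : IsFinal T σ) : config σ.bunch = config T := by
  obtain ⟨B, todo, i, ph⟩ := σ
  obtain ⟨rfl, rfl, rfl⟩ := hf
  obtain ⟨hg, B', r', hruns, hph, -⟩ := hσ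
  cases hruns
  cases hph with
  | stage _ _ hs _ => exact config_eq_of_prevSettled hg.items hs

/-! ### Executions -/

theorem StateInv.not_infinite (hI : Setting κ T K) (r : Rank ×ₗ ℕ) (f : ℕ → State n)
    (h : StateInv κ T K (f 0) r) (hf : ∀ k, Step κ T (f k) (f (k + 1))) : False := by
  induction r using WellFoundedLT.induction generalizing f with
  | _ r ih =>
    obtain ⟨r', hlt, h'⟩ := h.step hI (hf 0)
    exact ih r' hlt (fun k => f (k + 1)) h' fun k => hf (k + 1)

/-- `Solves` speaks about all maximal executions; to obtain a reconfiguration sequence from it, one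
such execution must exist. -/
theorem StateInv.exists_maximal (hI : Setting κ T K) (r : Rank ×ₗ ℕ) (σ : State n)
    (h : StateInv κ T K σ r) : ∃ E : List (State n), (σ :: E).IsChain (Step κ T) ∧
      ∀ τ, (σ :: E).getLast? = some τ → ∀ ρ, ¬ Step κ T τ ρ := by
  induction r using WellFoundedLT.induction generalizing σ with
  | _ r ih =>
    by_cases hst : ∃ τ, Step κ T σ τ
    · obtain ⟨τ, hst⟩ := hst
      obtain ⟨r', hlt, h'⟩ := h.step hI hst
      obtain ⟨E, hE, hlast⟩ := ih r' hlt τ h'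
      exact ⟨τ :: E, List.isChain_cons_cons.2 ⟨hst, hE⟩, by simpa using hlast⟩
    · refine ⟨[], by simp, fun τ hτ ρ hρ => hst ?_⟩
      obtain rfl : σ = τ := by simpa using hτ
      exact ⟨ρ, hρ⟩

theorem StateInv.chain (hI : Setting κ T K) (r : Rank ×ₗ ℕ) (σ : State n) (E : List (State n))
    (h : StateInv κ T K σ r) (hE : (σ :: E).IsChain (Step κ T)) :
    (∀ τ ∈ σ :: E, ∃ q, StateInv κ T K τ q) ∧
    ((σ :: E).map fun τ => config τ.bunch).IsChain fun C D => C = D ∨ Adjacent κ C D := by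
  induction E generalizing σ r with
  | nil =>
    refine ⟨fun τ hτ => ?_, by simp⟩
    obtain rfl : τ = σ := by simpa using hτ
    exact ⟨r, h⟩
  | cons τ E ih =>
    rw [List.isChain_cons_cons] at hE
    obtain ⟨r', -, h'⟩ := h.step hI hE.1
    obtain ⟨h1, h2⟩ := ih r' τ h' hE.2
    refine ⟨fun ρ hρ => ?_, ?_⟩
    · rcases List.mem_cons.1 hρ with rfl | hρ
      · exact ⟨r, h⟩
      · exact h1 ρ hρ
    · rw [List.map_cons, List.map_cons, List.isChain_cons_cons]
      exact ⟨h.config_step hE.1, h2⟩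

theorem exists_setting {CS CT : Config} {S : Fin n → Bunch} (hκ : ∃ a : ℕ, κ = 2 ^ a)
    (hCS : IsLegal κ CS) (hCT : IsLegal κ CT) (hU : underlying CS = underlying CT)
    (hpow : ∀ u ∈ underlying CS, ∃ a : ℕ, u = 2 ^ a)
    (hle : largestUnsettled CS CT ≤ totalSlack κ CS) (hS : config S = CS) (hT : config T = CT) :
    Setting κ T (totalSlack κ CS) ∧ ∃ r, StateInv κ T (totalSlack κ CS) (init S) r := by
  subst hS hT
  rw [underlying_config] at hU hpow
  rw [underlying_config] at hU
  have hg : Good κ T S := ⟨fun x => hCS _ (mem_config.2 ⟨x, rfl⟩), hU⟩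
  refine ⟨⟨hκ, fun y => hCT _ (mem_config.2 ⟨y, rfl⟩), hU ▸ hpow, fun B hB => ?_⟩, _,
    PhaseInv.stateInv hg (.stage hg (Nat.zero_le _) ?_ hle)⟩
  · rw [totalSlack_config]
    have h1 := hB.sum_slack
    have h2 := hg.sum_slack
    omega
  · intro k hk
    omega

theorem solves {κ : ℕ} {CS CT : Config} (hκ : ∃ a : ℕ, κ = 2 ^ a)
    (hCS : IsLegal κ CS) (hCT : IsLegal κ CT) (hU : underlying CS = underlying CT)
    (hpow : ∀ u ∈ underlying CS, ∃ a : ℕ, u = 2 ^ a)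
    (hle : largestUnsettled CS CT ≤ totalSlack κ CS) : Solves κ CS CT := by
  intro n S T hS hT
  obtain ⟨hI, r, hr⟩ := exists_setting hκ hCS hCT hU hpow hle hS hT
  refine ⟨fun ⟨f, hf0, hf⟩ => StateInv.not_infinite hI r f (hf0 ▸ hr) hf, fun E hE => ?_⟩
  obtain ⟨hhead, hchain, hmax⟩ := hE
  match E, hhead with
  | σ :: E, hhead =>
    obtain rfl : σ = init S := by simpa using hhead
    obtain ⟨h1, h2⟩ := StateInv.chain hI r _ E hr hchain
    obtain ⟨ρ, hρ⟩ : ∃ ρ, (init S :: E).getLast? = some ρ :=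
      ⟨_, List.getLast?_eq_some_getLast (List.cons_ne_nil _ _)⟩
    obtain ⟨q, hq⟩ := h1 ρ (List.mem_of_getLast? hρ)
    have hfin : IsFinal T ρ := (hq.exists_step hI).resolve_left fun ⟨τ, hτ⟩ => hmax ρ hρ τ hτ
    refine ⟨⟨ρ, hρ, hfin⟩, ?_⟩
    have hd := destutter'_spec _ _ h2
    rw [← List.map_cons (f := fun τ : State n => config τ.bunch), List.getLast?_map, hρ] at hd
    rw [List.map_cons, List.destutter_cons']
    refine ⟨hS ▸ hd.1, ?_, fun C hC => ?_, hd.2.2⟩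
    · rw [hd.2.1, Option.map_some, hq.config_eq hfin, hT]
    · have hC' := (List.destutter'_sublist _ _ _).subset hC
      rw [← List.map_cons (f := fun τ : State n => config τ.bunch)] at hC'
      obtain ⟨τ, hτ, rfl⟩ := List.mem_map.1 hC'
      obtain ⟨q, hq⟩ := h1 τ hτ
      exact hq.1.isLegal

theorem reconfigurable {κ : ℕ} {CS CT : Config} (hκ : ∃ a : ℕ, κ = 2 ^ a)
    (hCS : IsLegal κ CS) (hCT : IsLegal κ CT) (hcard : CS.card = CT.card)
    (hU : underlying CS = underlying CT) (hpow : ∀ u ∈ underlying CS, ∃ a : ℕ, u = 2 ^ a)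
    (hle : largestUnsettled CS CT ≤ totalSlack κ CS) : Reconfigurable κ CS CT := by
  obtain ⟨S, hS⟩ := exists_config_eq CS rfl
  obtain ⟨T, hT⟩ := exists_config_eq CT hcard.symm
  obtain ⟨hI, r, hr⟩ := exists_setting hκ hCS hCT hU hpow hle hS hT
  obtain ⟨E, hE, hmax⟩ := StateInv.exists_maximal hI r _ hr
  exact ⟨_, ((solves hκ hCS hCT hU hpow hle _ S T hS hT).2 _ ⟨rfl, hE, hmax⟩).2⟩

end SettleItems

end Repacking

/-- Reconfigurability enters the second claim only through the slack inequality that it implies. -/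
theorem theorem3 (κ : ℕ) (CS CT : Repacking.Config)
    (hκ : ∃ a : ℕ, κ = 2 ^ a)
    (hCS : Repacking.IsLegal κ CS) (hCT : Repacking.IsLegal κ CT)
    (hcard : CS.card = CT.card)
    (hU : Repacking.underlying CS = Repacking.underlying CT)
    (hpow : ∀ u ∈ Repacking.underlying CS, ∃ a : ℕ, u = 2 ^ a) :
    (Repacking.Reconfigurable κ CS CT ↔
        Repacking.largestUnsettled CS CT ≤ Repacking.totalSlack κ CS) ∧
      (Repacking.Reconfigurable κ CS CT → Repacking.SettleItems.Solves κ CS CT) :=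
  ⟨⟨fun h => h.largestUnsettled_le,
    Repacking.SettleItems.reconfigurable hκ hCS hCT hcard hU hpow⟩,
    fun h => Repacking.SettleItems.solves hκ hCS hCT hU hpow h.largestUnsettled_le⟩
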